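/- Let $n \geq 4$ and let $\Omega_n \subset \mathbb{C}^{n-2}$ be the set of tuples $(z_1,\ldots,z_{n-2})$ of pairwise distinct points of $\mathbb{C}\setminus\{0,1\}$. For a permutation $\sigma \in \mathfrak{S}_{n+1}$ and $z \in \Omega_n$ write $(p_1,\ldots,p_{n+1}) = (\infty,0,1,z_1,\ldots,z_{n-2})$ and let $M$ be the unique Möbius transformation with $M(p_{\sigma^{-1}(1)})=\infty$, $M(p_{\sigma^{-1}(2)})=0$, $M(p_{\sigma^{-1}(3)})=1$; put $\Theta_n(\sigma)(z) = \left(M(p_{\sigma^{-1}(4)}),\ldots,M(p_{\sigma^{-1}(n+1)})\right) \in \Omega_n$. This defines a homomorphism $\Theta_n$ from $\mathfrak{S}_{n+1}$ to the group of bijections of $\Omega_n$; let $\mathbb{G}_n$ be its image and let $\varphi$ be Euler's function. Let $T = \Theta_n(\sigma) \in \mathbb{G}_n$ have order $m \geq 2$ and suppose that its fixed locus $\mathrm{Fix}(T) = \{z \in \Omega_n : T(z)=z\}$ is non-empty. Then the number of cycles of length $m$ in the decomposition of $\sigma$ is $r+1$ for some integer $r \geq 0$, and the following hold. 1. Each connected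 component of $\mathrm{Fix}(T)$ is a complex submanifold of $\Omega_n$ of (complex) dimension $r$. 2. If $m=2$, then $\mathrm{Fix}(T)$ is connected. 3. If $m \geq 3$, then $\mathrm{Fix}(T)$ has exactly $\varphi(m)/2$ connected components if $m$ divides $n+1$, and exactly $\varphi(m)$ connected components otherwise. Moreover, if $F_1$ and $F_2$ are any two of the connected components, then there is an element $S \in \mathbb{G}_n$ normalising the cyclic group $\langle T \rangle$ such that $S(F_1)=F_2$. -/

import Mathlib

namespace MarkedSpheres

open OnePoint Matrix

noncomputable section

/-! The Riemann sphere is `OnePoint ℂ`, and `GL (Fin 2) ℂ` acts on it by Möbius transformations. -/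

/-- The space `Ω_n` of tuples `(z_1, …, z_{n-2})` of pairwise distinct points of `ℂ ∖ {0, 1}`
(with coordinates indexed from `0`). -/
def Omega (n : ℕ) : Set (Fin (n - 2) → ℂ) :=
  {z | (∀ i, z i ≠ 0 ∧ z i ≠ 1) ∧ Function.Injective z}

/-- The ordered `(n+1)`-tuple `(∞, 0, 1, z_1, …, z_{n-2})` of points of the Riemann sphere
(with positions indexed from `0`). -/
def marking {n : ℕ} (z : Fin (n - 2) → ℂ) (j : Fin (n + 1)) : OnePoint ℂ :=
  if j.val = 0 then ∞
  else if j.val = 1 then ((0 : ℂ) : OnePoint ℂ)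
  else if j.val = 2 then ((1 : ℂ) : OnePoint ℂ)
  else if h : j.val - 3 < n - 2 then ((z ⟨j.val - 3, h⟩ : ℂ) : OnePoint ℂ)
  else ∞

theorem marking_zero {n : ℕ} (z : Fin (n - 2) → ℂ) : marking z 0 = ∞ := by
  simp [marking]

theorem marking_one {n : ℕ} (hn : 3 ≤ n) (z : Fin (n - 2) → ℂ) :
    marking z ⟨1, by omega⟩ = ((0 : ℂ) : OnePoint ℂ) := by
  simp [marking]

theorem marking_two {n : ℕ} (hn : 3 ≤ n) (z : Fin (n - 2) → ℂ) :
    marking z ⟨2, by omega⟩ = ((1 : ℂ) : OnePoint ℂ) := by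
  simp [marking]

theorem marking_add_three {n : ℕ} (hn : 3 ≤ n) (z : Fin (n - 2) → ℂ) (i : Fin (n - 2)) :
    marking z ⟨i.val + 3, by omega⟩ = ((z i : ℂ) : OnePoint ℂ) := by
  simp [marking]

theorem marking_injective {n : ℕ} (z : Omega n) : Function.Injective (marking z.1) := by
  obtain ⟨z, hz, hinj⟩ := z
  intro a b hab
  have ha := a.isLt
  have hb := b.isLt
  have key : ∀ i k : Fin (n - 2), z i = z k → i.val = k.val := fun i k h => by rw [hinj h]
  have h0 := fun i => (hz i).1
  have h1 := fun i => (hz i).2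
  have h0' := fun i => (hz i).1.symm
  have h1' := fun i => (hz i).2.symm
  apply Fin.ext
  simp only [marking] at hab
  split_ifs at hab <;> first
    | omega
    | exact absurd (OnePoint.coe_injective hab) (h0 _)
    | exact absurd (OnePoint.coe_injective hab) (h1 _)
    | exact absurd (OnePoint.coe_injective hab) (h0' _)
    | exact absurd (OnePoint.coe_injective hab) (h1' _)
    | exact absurd (OnePoint.coe_injective hab) zero_ne_one
    | exact absurd (OnePoint.coe_injective hab) one_ne_zero
    | exact absurd hab (OnePoint.infty_ne_coe _)
    | exact absurd hab (OnePoint.coe_ne_infty _)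
    | (have h := key _ _ (OnePoint.coe_injective hab)
       simp only at h
       omega)

/-- Möbius transformations act transitively on triples of distinct points. -/
theorem exists_mobius {a b c : OnePoint ℂ} (hab : a ≠ b) (hac : a ≠ c) (hbc : b ≠ c) :
    ∃ g : GL (Fin 2) ℂ, g • a = ∞ ∧ g • b = ((0 : ℂ) : OnePoint ℂ) ∧
      g • c = ((1 : ℂ) : OnePoint ℂ) := by
  have affine : ∀ b c : OnePoint ℂ, ∞ ≠ b → ∞ ≠ c → b ≠ c →
      ∃ g : GL (Fin 2) ℂ, g • (∞ : OnePoint ℂ) = ∞ ∧ g • b = ((0 : ℂ) : OnePoint ℂ) ∧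
        g • c = ((1 : ℂ) : OnePoint ℂ) := by
    intro b c hb hc hbc
    induction b using OnePoint.rec with
    | infty => exact absurd rfl hb
    | coe b =>
      induction c using OnePoint.rec with
      | infty => exact absurd rfl hc
      | coe c =>
        have hne : c - b ≠ 0 := fun h => hbc (by rw [sub_eq_zero.1 h])
        refine ⟨Matrix.GeneralLinearGroup.mkOfDetNeZero !![1, -b; 0, c - b]
          (by simpa [Matrix.det_fin_two] using hne), ?_, ?_, ?_⟩
        · rw [smul_infty_eq_ite]
          simp [Matrix.GeneralLinearGroup.mkOfDetNeZero]
        · rw [smul_some_eq_ite]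
          simp [Matrix.GeneralLinearGroup.mkOfDetNeZero, hne]
        · rw [smul_some_eq_ite]
          simp [Matrix.GeneralLinearGroup.mkOfDetNeZero, hne, ← sub_eq_add_neg]
  have move : ∃ g : GL (Fin 2) ℂ, g • a = ∞ := by
    induction a using OnePoint.rec with
    | infty => exact ⟨1, one_smul _ _⟩
    | coe a =>
      refine ⟨Matrix.GeneralLinearGroup.mkOfDetNeZero !![0, 1; 1, -a]
        (by simp [Matrix.det_fin_two]), ?_⟩
      rw [smul_some_eq_ite]
      simp [Matrix.GeneralLinearGroup.mkOfDetNeZero]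
  obtain ⟨g, hg⟩ := move
  obtain ⟨h, h1, h2, h3⟩ := affine (g • b) (g • c)
    (by rw [← hg]; exact fun h => hab (MulAction.injective g h))
    (by rw [← hg]; exact fun h => hac (MulAction.injective g h))
    (fun h => hbc (MulAction.injective g h))
  exact ⟨h * g, by rw [mul_smul, hg, h1], by rw [mul_smul, h2], by rw [mul_smul, h3]⟩

/-- A Möbius transformation fixing `∞`, `0` and `1` is the identity. -/
theorem mobius_eq_self {g : GL (Fin 2) ℂ} (h0 : g • (∞ : OnePoint ℂ) = ∞)
    (h1 : g • ((0 : ℂ) : OnePoint ℂ) = ((0 : ℂ) : OnePoint ℂ))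
    (h2 : g • ((1 : ℂ) : OnePoint ℂ) = ((1 : ℂ) : OnePoint ℂ)) (x : OnePoint ℂ) : g • x = x := by
  have hc := smul_infty_eq_self_iff.1 h0
  have hd : g 1 1 ≠ 0 := by
    intro hd
    exact g.det_ne_zero (by rw [Matrix.det_fin_two, hc, hd]; ring)
  rw [smul_some_eq_ite] at h1 h2
  simp only [hc, mul_zero, mul_one, zero_add, hd, if_false, OnePoint.coe_eq_coe] at h1 h2
  have hb : g 0 1 = 0 := by
    rcases div_eq_zero_iff.1 h1 with h | h
    · exact h
    · exact absurd h hd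
  have ha : g 0 0 = g 1 1 := by
    rw [hb, add_zero, div_eq_one_iff_eq hd] at h2
    exact h2
  induction x using OnePoint.rec with
  | infty => exact h0
  | coe x =>
    rw [smul_some_eq_ite]
    simp [hc, hd, hb, ha]

/-- Every ordered tuple of distinct points of the sphere is Möbius equivalent to exactly one
tuple `(∞, 0, 1, w_1, …, w_{n-2})` with `w ∈ Ω_n`. -/
theorem existsUnique_normal_form {n : ℕ} (hn : 3 ≤ n) (q : Fin (n + 1) → OnePoint ℂ)
    (hq : Function.Injective q) :
    ∃! w : Omega n, ∃ g : GL (Fin 2) ℂ, ∀ j, g • q j = marking w.1 j := by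
  obtain ⟨g, g0, g1, g2⟩ := exists_mobius (a := q 0) (b := q ⟨1, by omega⟩) (c := q ⟨2, by omega⟩)
    (fun h => by simpa [Fin.ext_iff] using hq h) (fun h => by simpa [Fin.ext_iff] using hq h)
    (fun h => by simpa [Fin.ext_iff] using hq h)
  have hgq : Function.Injective fun j => g • q j := (MulAction.injective g).comp hq
  have fin : ∀ i : Fin (n - 2), ∃ w : ℂ, (w : OnePoint ℂ) = g • q ⟨i.val + 3, by omega⟩ := by
    intro i
    refine OnePoint.ne_infty_iff_exists.1 ?_
    intro h
    have := hgq (a₁ := ⟨i.val + 3, by omega⟩) (a₂ := 0) (by simp only [h, g0])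
    simp [Fin.ext_iff] at this
  choose w hw using fin
  have hval : ∀ j, g • q j = marking w j := by
    intro j
    rcases j with ⟨_ | _ | _ | j, hj⟩
    · exact g0.trans (marking_zero w).symm
    · exact g1.trans (marking_one hn w).symm
    · exact g2.trans (marking_two hn w).symm
    · have := marking_add_three hn w ⟨j, by omega⟩
      exact (hw ⟨j, by omega⟩).symm.trans this.symm
  have hwO : w ∈ Omega n := by
    refine ⟨fun i => ⟨fun h => ?_, fun h => ?_⟩, fun i k h => ?_⟩
    · have := hgq (a₁ := ⟨i.val + 3, by omega⟩) (a₂ := ⟨1, by omega⟩)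
        (by simp only [← hw, g1, h])
      simp [Fin.ext_iff] at this
    · have := hgq (a₁ := ⟨i.val + 3, by omega⟩) (a₂ := ⟨2, by omega⟩)
        (by simp only [← hw, g2, h])
      simp [Fin.ext_iff] at this
    · have := hgq (a₁ := ⟨i.val + 3, by omega⟩) (a₂ := ⟨k.val + 3, by omega⟩)
        (by simp only [← hw, h])
      simpa [Fin.ext_iff] using this
  refine ⟨⟨w, hwO⟩, ⟨g, hval⟩, ?_⟩
  rintro ⟨v, hv⟩ ⟨h, hh⟩
  have hfix : ∀ x : OnePoint ℂ, (h * g⁻¹) • x = x := by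
    have aux : ∀ j, (h * g⁻¹) • marking w j = marking v j := by
      intro j
      rw [← hval j, mul_smul, inv_smul_smul, hh j]
    refine mobius_eq_self ?_ ?_ ?_
    · simpa only [marking_zero] using aux 0
    · simpa only [marking_one hn] using aux ⟨1, by omega⟩
    · simpa only [marking_two hn] using aux ⟨2, by omega⟩
  apply Subtype.ext
  funext i
  have h3 := hh ⟨i.val + 3, by omega⟩
  have h4 := hval ⟨i.val + 3, by omega⟩
  have h5 := hfix (marking w ⟨i.val + 3, by omega⟩)
  rw [← h4, mul_smul, inv_smul_smul, h3, h4] at h5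
  simp only [marking_add_three hn] at h5
  exact OnePoint.coe_injective h5

/-- The map `T_σ : Ω_n → Ω_n`. With `(p_1, …, p_{n+1}) = (∞, 0, 1, z_1, …, z_{n-2})`, the point
`T_σ(z)` is the unique `w ∈ Ω_n` such that some Möbius transformation `M` satisfies
`(M(p_{σ⁻¹(1)}), …, M(p_{σ⁻¹(n+1)})) = (∞, 0, 1, w_1, …, w_{n-2})`. -/
def permute {n : ℕ} (hn : 3 ≤ n) (σ : Equiv.Perm (Fin (n + 1))) (z : Omega n) : Omega n :=
  (existsUnique_normal_form hn (fun j => marking z.1 (σ⁻¹ j))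
    ((marking_injective z).comp (σ⁻¹).injective)).choose

theorem permute_spec {n : ℕ} (hn : 3 ≤ n) (σ : Equiv.Perm (Fin (n + 1))) (z : Omega n) :
    ∃ g : GL (Fin 2) ℂ, ∀ j, g • marking z.1 (σ⁻¹ j) = marking (permute hn σ z).1 j :=
  (existsUnique_normal_form hn (fun j => marking z.1 (σ⁻¹ j))
    ((marking_injective z).comp (σ⁻¹).injective)).choose_spec.1

theorem permute_eq {n : ℕ} (hn : 3 ≤ n) {σ : Equiv.Perm (Fin (n + 1))} {z w : Omega n}
    (g : GL (Fin 2) ℂ) (hg : ∀ j, g • marking z.1 (σ⁻¹ j) = marking w.1 j) :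
    permute hn σ z = w :=
  ((existsUnique_normal_form hn (fun j => marking z.1 (σ⁻¹ j))
    ((marking_injective z).comp (σ⁻¹).injective)).choose_spec.2 w ⟨g, hg⟩).symm

/-- The homomorphism `Θ_n` from the symmetric group on `n + 1` symbols to the bijections of
`Ω_n`, sending `σ` to `T_σ`. -/
def Theta (n : ℕ) (hn : 3 ≤ n) : Equiv.Perm (Fin (n + 1)) →* Equiv.Perm (Omega n) :=
  MonoidHom.toHomPerm
    { toFun := fun σ => (permute hn σ : Omega n → Omega n)
      map_one' := by
        funext z
        exact permute_eq hn 1 fun j => by rw [one_smul, inv_one]; rfl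
      map_mul' := by
        intro σ τ
        funext z
        obtain ⟨g, hg⟩ := permute_spec hn τ z
        obtain ⟨h, hh⟩ := permute_spec hn σ (permute hn τ z)
        refine permute_eq hn (h * g) fun j => ?_
        rw [mul_smul, _root_.mul_inv_rev, Equiv.Perm.mul_apply, hg, hh]
        rfl }

/-- The group `𝔾_n` of all the transformations `T_σ` of `Ω_n`. -/
def torelliGroup (n : ℕ) (hn : 3 ≤ n) : Subgroup (Equiv.Perm (Omega n)) := (Theta n hn).range

/-- The locus of fixed points of a bijection. -/
def Fix {X : Type*} (T : Equiv.Perm X) : Set X := {x | T x = x}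

/-- The set of the connected components of a subset of a topological space. -/
def components {X : Type*} [TopologicalSpace X] (F : Set X) : Set (Set X) :=
  (fun x => connectedComponentIn F x) '' F

/-- `S` is a complex submanifold of dimension `r` of `ℂ^N`: around each of its points there is
a biholomorphic map between open subsets of `ℂ^N` that straightens `S` to the coordinate
subspace in which all but the first `r` coordinates vanish. -/
def IsComplexSubmanifold {N : ℕ} (S : Set (Fin N → ℂ)) (r : ℕ) : Prop :=
  r ≤ N ∧ ∀ x ∈ S, ∃ φ : OpenPartialHomeomorph (Fin N → ℂ) (Fin N → ℂ),
    x ∈ φ.source ∧ DifferentiableOn ℂ φ φ.source ∧ DifferentiableOn ℂ φ.symm φ.target ∧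
      ∀ y ∈ φ.source, y ∈ S ↔ ∀ i : Fin N, r ≤ i.val → φ y i = 0

end

end MarkedSpheres

/-!
A point `z` of `Ω_n` is fixed by `T_σ` exactly when some Möbius transformation `g` permutes the
`n + 1` points `∞, 0, 1, z_1, …, z_{n-2}` by `σ`. If `g` is not the identity, it has finite order
and is therefore conjugate to a multiplication `y ↦ ζ y` by a primitive root of unity
(`exists_conj_dil`). Its order is that of `σ`, which is also the order `m` of `T_σ` because for
`n ≥ 4` the action is faithful (`Theta_injective`). As multiplication by `ζ` fixes `0` and `∞` and
moves all other points in orbits of length `m`, the permutation `σ` has `r + 1` cycles of length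
`m` and `e ≤ 2` fixed points (`exists_coordinates_of_fixed`), so `n + 1 = m (r + 1) + e`.

Conversely, for a given `ζ` the configurations permuted by `y ↦ ζ y` according to `σ` are described
by one base point for each cycle. After scaling the first base point to `1`, the others form a
vector in the open set of `ℂ^r` where the points of the configuration are distinct
(`eigenLocus_eq_familyLocus`). If there is a fixed label, the first one is put at `∞`, so that `ζ`
is determined by the configuration; otherwise `y ↦ 1 / y` identifies the configurations for `ζ` with
those for `ζ⁻¹`. In this way the fixed locus is a union of eigenloci, one for each primitive `m`-th
root of unity, or one for each pair of inverse ones if `e = 0`.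

* Each eigenlocus is connected, because a complex line meets the complement of the parameter set in
  finitely many points (`isPreconnected_of_polynomial_lines`).
* It is a submanifold, because the parameters can be recovered holomorphically from cross-ratios
  with three points that do not move in the family (`isComplexSubmanifold_image`,
  `isComplexSubmanifold_familyLocus`). When `m = 2` and `e = 0`, the diagonal family has only two
  points that stay in place; it is replaced by the family of the involutions `y ↦ c / y`
  (`Fix_eq_familyLocus`).
* For `m ≥ 3` a cross-ratio of consecutive points of a cycle is a continuous function on `Ω_n` that
  takes distinct constant values on distinct eigenloci, so these are the connected components
  (`exists_separating_function`, `components_Fix`). There are `φ(m)` of them, or `φ(m) / 2` if `e = 0`, that is if `m ∣ n + 1`.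
* For a unit `u` modulo `m`, the permutation that multiplies the positions in each cycle by `u`
  conjugates `σ` to a power of `σ`, and takes the eigenlocus of `ζ` to that of a power of `ζ`
  (`Theta_mem_eigenLocus`). All primitive roots of unity are obtained in this way
  (`exists_normalizing`).
-/

namespace MarkedSpheres

open OnePoint Matrix

noncomputable section

/-! ### Homogeneous coordinates and cross-ratios -/

/-- The point of the Riemann sphere with homogeneous coordinates `v`. The value at `v = 0` is `∞`
and carries no meaning. -/
def pt (v : Fin 2 → ℂ) : OnePoint ℂ := if v 1 = 0 then ∞ else ((v 0 / v 1 : ℂ) : OnePoint ℂ)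

/-- The determinant of the matrix with columns `v` and `w`; it vanishes exactly when `v` and `w`
are homogeneous coordinates of the same point. -/
def bracket (v w : Fin 2 → ℂ) : ℂ := v 0 * w 1 - v 1 * w 0

theorem bracket_self (v : Fin 2 → ℂ) : bracket v v = 0 := by
  simp only [bracket]
  ring

theorem ne_zero_of_bracket_left {v w : Fin 2 → ℂ} (h : bracket v w ≠ 0) : v ≠ 0 := by
  rintro rfl
  simp [bracket] at h

theorem ne_zero_of_bracket_right {v w : Fin 2 → ℂ} (h : bracket v w ≠ 0) : w ≠ 0 := by
  rintro rfl
  simp [bracket] at h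

theorem pt_eq_infty_iff {v : Fin 2 → ℂ} : pt v = ∞ ↔ v 1 = 0 := by
  by_cases h : v 1 = 0 <;> simp [pt, h]

theorem pt_of_ne {v : Fin 2 → ℂ} (h : v 1 ≠ 0) : pt v = ((v 0 / v 1 : ℂ) : OnePoint ℂ) := by
  simp [pt, h]

theorem fst_ne_zero {v : Fin 2 → ℂ} (hv : v ≠ 0) (h : v 1 = 0) : v 0 ≠ 0 := by
  intro h0
  apply hv
  ext i
  fin_cases i <;> simp [h, h0]

theorem pt_eq_pt_iff {v w : Fin 2 → ℂ} (hv : v ≠ 0) (hw : w ≠ 0) :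
    pt v = pt w ↔ bracket v w = 0 := by
  by_cases h : v 1 = 0 <;> by_cases h' : w 1 = 0
  · simp [pt, bracket, h, h']
  · simp [pt, bracket, h, h', fst_ne_zero hv h]
  · simp [pt, bracket, h, h', fst_ne_zero hw h']
  · simp only [pt, bracket, h, h', if_false, OnePoint.coe_eq_coe]
    rw [div_eq_div_iff h h', sub_eq_zero, mul_comm (v 1)]

theorem smul_pt (g : GL (Fin 2) ℂ) {v : Fin 2 → ℂ} (hv : v ≠ 0) :
    g • pt v = pt ((g : Matrix (Fin 2) (Fin 2) ℂ) *ᵥ v) := by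
  by_cases h : v 1 = 0
  · have h0 := fst_ne_zero hv h
    rw [pt_eq_infty_iff.2 h, smul_infty_eq_ite]
    by_cases hc : g 1 0 = 0
    · simp [pt, hc, h]
    · simp [pt, hc, h, h0, mul_div_mul_right _ _ h0]
  · rw [pt_of_ne h, smul_some_eq_ite]
    have e : g 1 0 * (v 0 / v 1) + g 1 1 = (g 1 0 * v 0 + g 1 1 * v 1) / v 1 := by field_simp
    have e' : g 0 0 * (v 0 / v 1) + g 0 1 = (g 0 0 * v 0 + g 0 1 * v 1) / v 1 := by field_simp
    rw [e, e', div_div_div_cancel_right₀ h]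
    simp only [div_eq_zero_iff, h, or_false]
    simp [pt]

/-- The cross-ratio of four points given by homogeneous coordinates: the value at the fourth point
of the Möbius transformation that sends the first three to `∞`, `0` and `1`. -/
def crossRatio (a b c d : Fin 2 → ℂ) : ℂ :=
  bracket b d * bracket a c / (bracket a d * bracket b c)

theorem exists_mobius_crossRatio {a b c : Fin 2 → ℂ} (hab : bracket a b ≠ 0)
    (hac : bracket a c ≠ 0) (hbc : bracket b c ≠ 0) :
    ∃ g : GL (Fin 2) ℂ, g • pt a = ∞ ∧ g • pt b = ((0 : ℂ) : OnePoint ℂ) ∧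
      g • pt c = ((1 : ℂ) : OnePoint ℂ) ∧
      ∀ d, bracket a d ≠ 0 → g • pt d = ((crossRatio a b c d : ℂ) : OnePoint ℂ) := by
  have ha := ne_zero_of_bracket_left hab
  let M : Matrix (Fin 2) (Fin 2) ℂ :=
    !![-(b 1) * bracket a c, b 0 * bracket a c; -(a 1) * bracket b c, a 0 * bracket b c]
  have hM : M.det ≠ 0 := by
    have : M.det = bracket a c * bracket b c * -bracket a b := by
      simp only [M, Matrix.det_fin_two_of]
      simp only [bracket]
      ring
    rw [this]
    exact mul_ne_zero (mul_ne_zero hac hbc) (neg_ne_zero.2 hab)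
  let g : GL (Fin 2) ℂ := Matrix.GeneralLinearGroup.mkOfDetNeZero M hM
  have act : ∀ d, d ≠ 0 →
      g • pt d = pt ![bracket b d * bracket a c, bracket a d * bracket b c] := by
    intro d hd
    rw [smul_pt g hd]
    congr 1
    rw [Matrix.mulVec_fin_two]
    have e : (g : Matrix (Fin 2) (Fin 2) ℂ) = M := rfl
    rw [e]
    ext i
    fin_cases i <;> simp [M, bracket] <;> ring
  have fin : ∀ d, bracket a d ≠ 0 → g • pt d = ((crossRatio a b c d : ℂ) : OnePoint ℂ) := by
    intro d hd
    rw [act d (ne_zero_of_bracket_right hd), pt_of_ne (by simp [hd, hbc])]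
    rfl
  refine ⟨g, ?_, ?_, ?_, fin⟩
  · rw [act a ha, pt_eq_infty_iff]
    simp [bracket_self]
  · rw [fin b hab]
    simp [crossRatio, bracket_self]
  · rw [fin c hac, crossRatio, mul_comm, div_self (mul_ne_zero hac hbc)]

/-- Two Möbius transformations that agree at three distinct points are equal. -/
theorem mobius_eq_of_eq_three {g h : GL (Fin 2) ℂ} {a b c : OnePoint ℂ} (hab : a ≠ b) (hac : a ≠ c)
    (hbc : b ≠ c) (ha : g • a = h • a) (hb : g • b = h • b) (hc : g • c = h • c)
    (x : OnePoint ℂ) : g • x = h • x := by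
  obtain ⟨k, k0, k1, k2⟩ := exists_mobius hab hac hbc
  have key : ∀ y : OnePoint ℂ, (k * (h⁻¹ * g) * k⁻¹) • y = y := by
    have e : ∀ (p q : OnePoint ℂ), k • p = q → g • p = h • p →
        (k * (h⁻¹ * g) * k⁻¹) • q = q := by
      rintro p q rfl hp
      rw [mul_smul, inv_smul_smul, mul_smul, mul_smul, hp, inv_smul_smul]
    exact mobius_eq_self (e _ _ k0 ha) (e _ _ k1 hb) (e _ _ k2 hc)
  have := key (k • x)
  rw [mul_smul, inv_smul_smul, mul_smul, mul_smul] at this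
  rw [← inv_smul_eq_iff]
  exact MulAction.injective k this

/-- Cross-ratios are invariant under Möbius transformations. -/
theorem crossRatio_eq_of_smul {a b c d a' b' c' d' : Fin 2 → ℂ} (hab : bracket a b ≠ 0)
    (hac : bracket a c ≠ 0) (hbc : bracket b c ≠ 0) (had : bracket a d ≠ 0)
    (hab' : bracket a' b' ≠ 0) (hac' : bracket a' c' ≠ 0) (hbc' : bracket b' c' ≠ 0)
    (had' : bracket a' d' ≠ 0) (h : GL (Fin 2) ℂ) (ha : h • pt a = pt a') (hb : h • pt b = pt b')
    (hc : h • pt c = pt c') (hd : h • pt d = pt d') :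
    crossRatio a b c d = crossRatio a' b' c' d' := by
  obtain ⟨g, g0, g1, g2, g3⟩ := exists_mobius_crossRatio hab hac hbc
  obtain ⟨k, k0, k1, k2, k3⟩ := exists_mobius_crossRatio hab' hac' hbc'
  have na := ne_zero_of_bracket_left hab
  have nb := ne_zero_of_bracket_right hab
  have nc := ne_zero_of_bracket_right hac
  have key : g • pt d = (k * h) • pt d := by
    refine mobius_eq_of_eq_three (mt (pt_eq_pt_iff na nb).1 hab) (mt (pt_eq_pt_iff na nc).1 hac)
      (mt (pt_eq_pt_iff nb nc).1 hbc) ?_ ?_ ?_ _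
    · rw [mul_smul, ha, g0, k0]
    · rw [mul_smul, hb, g1, k1]
    · rw [mul_smul, hc, g2, k2]
  rw [mul_smul, hd, g3 d had, k3 d' had'] at key
  exact OnePoint.coe_injective key

/-! ### Configurations of points and their normal forms -/

/-- The tuple `z` is the normal form of the configuration `q` of `n + 1` points of the sphere:
some Möbius transformation carries `(∞, 0, 1, z_1, …, z_{n-2})` to `q`. -/
def Represents {n : ℕ} (z : Omega n) (q : Fin (n + 1) → OnePoint ℂ) : Prop :=
  ∃ h : GL (Fin 2) ℂ, ∀ i, h • marking z.1 i = q i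

theorem Represents.injective {n : ℕ} {z : Omega n} {q : Fin (n + 1) → OnePoint ℂ}
    (h : Represents z q) : Function.Injective q := by
  obtain ⟨h, hh⟩ := h
  intro i j hij
  rw [← hh i, ← hh j] at hij
  exact marking_injective z (MulAction.injective h hij)

theorem Represents.unique {n : ℕ} (hn : 3 ≤ n) {z w : Omega n} {q : Fin (n + 1) → OnePoint ℂ}
    (hz : Represents z q) (hw : Represents w q) : z = w := by
  refine (existsUnique_normal_form hn q hz.injective).unique ?_ ?_
  · obtain ⟨h, hh⟩ := hz
    exact ⟨h⁻¹, fun j => by rw [← hh, inv_smul_smul]⟩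
  · obtain ⟨h, hh⟩ := hw
    exact ⟨h⁻¹, fun j => by rw [← hh, inv_smul_smul]⟩

theorem exists_represents {n : ℕ} (hn : 3 ≤ n) {q : Fin (n + 1) → OnePoint ℂ}
    (hq : Function.Injective q) : ∃ z, Represents z q := by
  obtain ⟨w, ⟨g, hg⟩, -⟩ := existsUnique_normal_form hn q hq
  exact ⟨w, g⁻¹, fun j => by rw [← hg, inv_smul_smul]⟩

/-- Homogeneous coordinates of `∞, 0, 1, z_1, …, z_{n-2}`. -/
def markingVec {n : ℕ} (z : Fin (n - 2) → ℂ) (j : Fin (n + 1)) : Fin 2 → ℂ :=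
  if j.val = 0 then ![1, 0]
  else if j.val = 1 then ![0, 1]
  else if j.val = 2 then ![1, 1]
  else if h : j.val - 3 < n - 2 then ![z ⟨j.val - 3, h⟩, 1]
  else ![1, 0]

theorem markingVec_ne_zero {n : ℕ} (z : Fin (n - 2) → ℂ) (j : Fin (n + 1)) :
    markingVec z j ≠ 0 := by
  intro h
  have h0 := congrFun h 0
  have h1 := congrFun h 1
  revert h0 h1
  simp only [markingVec]
  split_ifs <;> simp

theorem pt_markingVec {n : ℕ} (z : Fin (n - 2) → ℂ) (j : Fin (n + 1)) :
    pt (markingVec z j) = marking z j := by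
  simp only [markingVec, marking]
  split_ifs <;> simp [pt]

theorem bracket_markingVec_ne_zero {n : ℕ} (z : Omega n) {i j : Fin (n + 1)} (h : i ≠ j) :
    bracket (markingVec z.1 i) (markingVec z.1 j) ≠ 0 := by
  rw [Ne, ← pt_eq_pt_iff (markingVec_ne_zero _ _) (markingVec_ne_zero _ _), pt_markingVec,
    pt_markingVec]
  exact fun e => h (marking_injective z e)

theorem contDiff_markingVec {n : ℕ} (j : Fin (n + 1)) (c : Fin 2) :
    ContDiff ℂ 1 fun z : Fin (n - 2) → ℂ => markingVec z j c := by
  simp only [markingVec]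
  split_ifs <;> fin_cases c <;> simp <;> fun_prop

/-- A family of vectors gives homogeneous coordinates of pairwise distinct points. -/
def Nondegenerate {n : ℕ} (v : Fin (n + 1) → Fin 2 → ℂ) : Prop :=
  ∀ i j, i ≠ j → bracket (v i) (v j) ≠ 0

theorem Nondegenerate.ne_zero {n : ℕ} (hn : 3 ≤ n) {v : Fin (n + 1) → Fin 2 → ℂ}
    (hv : Nondegenerate v) (i : Fin (n + 1)) : v i ≠ 0 := by
  by_cases h : i = 0
  · subst h
    exact ne_zero_of_bracket_left (hv 0 ⟨1, by omega⟩ (by simp [Fin.ext_iff]))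
  · exact ne_zero_of_bracket_left (hv i 0 h)

theorem Nondegenerate.injective {n : ℕ} (hn : 3 ≤ n) {v : Fin (n + 1) → Fin 2 → ℂ}
    (hv : Nondegenerate v) : Function.Injective fun i => pt (v i) := by
  intro i j hij
  by_contra h
  exact hv i j h ((pt_eq_pt_iff (hv.ne_zero hn i) (hv.ne_zero hn j)).1 hij)

theorem nondegenerate_of_injective {n : ℕ} {v : Fin (n + 1) → Fin 2 → ℂ}
    (h0 : ∀ i, v i ≠ 0) (hv : Function.Injective fun i => pt (v i)) : Nondegenerate v :=
  fun i j h e => h (hv ((pt_eq_pt_iff (h0 i) (h0 j)).2 e))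

/-- The normal form of a configuration given by homogeneous coordinates. -/
def normalForm {n : ℕ} (hn : 3 ≤ n) (v : Fin (n + 1) → Fin 2 → ℂ) (k : Fin (n - 2)) : ℂ :=
  crossRatio (v ⟨0, by omega⟩) (v ⟨1, by omega⟩) (v ⟨2, by omega⟩) (v ⟨k.val + 3, by omega⟩)

theorem Represents.eq_normalForm {n : ℕ} (hn : 3 ≤ n) {v : Fin (n + 1) → Fin 2 → ℂ}
    (hv : Nondegenerate v) {z : Omega n} (hz : Represents z fun i => pt (v i)) :
    z.1 = normalForm hn v := by
  obtain ⟨h, hh⟩ := hz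
  have ne : ∀ a b : ℕ, ∀ (ha : a < n + 1) (hb : b < n + 1), a ≠ b →
      bracket (v ⟨a, ha⟩) (v ⟨b, hb⟩) ≠ 0 := fun a b ha hb hab => hv _ _ (by simpa using hab)
  obtain ⟨g, g0, g1, g2, g3⟩ := exists_mobius_crossRatio
    (ne 0 1 (by omega) (by omega) (by simp)) (ne 0 2 (by omega) (by omega) (by simp))
    (ne 1 2 (by omega) (by omega) (by simp))
  have fix : ∀ x : OnePoint ℂ, (g * h) • x = x := by
    apply mobius_eq_self
    · rw [mul_smul, ← marking_zero z.1, hh]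
      exact g0.trans (marking_zero z.1).symm
    · rw [mul_smul, ← marking_one hn z.1, hh]
      exact g1.trans (marking_one hn z.1).symm
    · rw [mul_smul, ← marking_two hn z.1, hh]
      exact g2.trans (marking_two hn z.1).symm
  funext k
  have e := fix (marking z.1 ⟨k.val + 3, by omega⟩)
  rw [mul_smul, hh, g3 _ (ne 0 _ (by omega) (by omega) (by simp)), marking_add_three hn] at e
  exact (OnePoint.coe_injective e).symm

theorem exists_represents_normalForm {n : ℕ} (hn : 3 ≤ n) {v : Fin (n + 1) → Fin 2 → ℂ}
    (hv : Nondegenerate v) :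
    ∃ z : Omega n, z.1 = normalForm hn v ∧ Represents z fun i => pt (v i) := by
  obtain ⟨z, hz⟩ := exists_represents hn (hv.injective hn)
  exact ⟨z, hz.eq_normalForm hn hv, hz⟩

theorem Represents.crossRatio_eq {n : ℕ} {v : Fin (n + 1) → Fin 2 → ℂ}
    (hv : Nondegenerate v) {z : Omega n} (hz : Represents z fun i => pt (v i))
    {a b c d : Fin (n + 1)} (hab : a ≠ b) (hac : a ≠ c) (hbc : b ≠ c) (had : a ≠ d) :
    crossRatio (markingVec z.1 a) (markingVec z.1 b) (markingVec z.1 c) (markingVec z.1 d) =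
      crossRatio (v a) (v b) (v c) (v d) := by
  obtain ⟨h, hh⟩ := hz
  exact crossRatio_eq_of_smul (bracket_markingVec_ne_zero z hab) (bracket_markingVec_ne_zero z hac)
    (bracket_markingVec_ne_zero z hbc) (bracket_markingVec_ne_zero z had) (hv _ _ hab) (hv _ _ hac)
    (hv _ _ hbc) (hv _ _ had) h (by rw [pt_markingVec, hh]) (by rw [pt_markingVec, hh])
    (by rw [pt_markingVec, hh]) (by rw [pt_markingVec, hh])

/-! ### The action of the symmetric group -/

theorem Theta_apply_eq_iff {n : ℕ} (hn : 3 ≤ n) (σ : Equiv.Perm (Fin (n + 1))) (z w : Omega n) :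
    Theta n hn σ z = w ↔
      ∃ g : GL (Fin 2) ℂ, ∀ i, g • marking z.1 i = marking w.1 (σ i) := by
  have e : Theta n hn σ z = permute hn σ z := rfl
  rw [e]
  constructor
  · rintro rfl
    obtain ⟨g, hg⟩ := permute_spec hn σ z
    exact ⟨g, fun i => by rw [← hg, show σ⁻¹ (σ i) = i from σ.symm_apply_apply i]⟩
  · rintro ⟨g, hg⟩
    exact permute_eq hn g fun j => by rw [hg, show σ (σ⁻¹ j) = j from σ.apply_symm_apply j]

theorem exists_three_distinct_ne {n : ℕ} (hn : 4 ≤ n) (a b : Fin (n + 1)) :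
    ∃ u v w : Fin (n + 1), u ≠ v ∧ u ≠ w ∧ v ≠ w ∧ (u ≠ a ∧ u ≠ b) ∧ (v ≠ a ∧ v ≠ b) ∧
      (w ≠ a ∧ w ≠ b) := by
  have h : 2 < (({a, b} : Finset (Fin (n + 1)))ᶜ).card := by
    rw [Finset.card_compl, Fintype.card_fin]
    have := Finset.card_le_two (a := a) (b := b)
    omega
  obtain ⟨u, v, w, hu, hv, hw, huv, huw, hvw⟩ := Finset.two_lt_card_iff.1 h
  simp only [Finset.mem_compl, Finset.mem_insert, Finset.mem_singleton, not_or] at hu hv hw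
  exact ⟨u, v, w, huv, huw, hvw, hu, hv, hw⟩

/-- For at least five points the action on normal forms is faithful: if `σ` moves `a`, a Möbius
transformation realising `σ` is determined by three points whose positions, and whose images'
positions, do not involve the position of `a`, so it cannot follow a displacement of `a` alone. -/
theorem Theta_injective {n : ℕ} (hn : 4 ≤ n) :
    Function.Injective (Theta n (Nat.le_of_succ_le hn)) := by
  have hn3 := Nat.le_of_succ_le hn
  rw [injective_iff_map_eq_one]
  intro σ hσ
  by_contra hne
  obtain ⟨a, ha⟩ : ∃ a, σ a ≠ a := by
    by_contra h
    push Not at h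
    exact hne (Equiv.ext h)
  obtain ⟨u, v, w, huv, huw, hvw, hu, hv, hw⟩ := exists_three_distinct_ne hn a (σ⁻¹ a)
  have act : ∀ q : Fin (n + 1) → OnePoint ℂ, Function.Injective q →
      ∃ g : GL (Fin 2) ℂ, ∀ i, g • q i = q (σ i) := by
    intro q hq
    obtain ⟨z, h, hh⟩ := exists_represents hn3 hq
    obtain ⟨g, hg⟩ := (Theta_apply_eq_iff hn3 σ z z).1 (by rw [hσ]; rfl)
    exact ⟨h * g * h⁻¹, fun i => by
      rw [← hh i, ← hh (σ i), mul_smul, inv_smul_smul, mul_smul, hg]⟩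
  let q : ℂ → Fin (n + 1) → OnePoint ℂ := fun t i => if i = a then (t : OnePoint ℂ) else
    (((i.val : ℕ) : ℂ) : OnePoint ℂ)
  have hq : ∀ t : ℂ, (∀ k : ℕ, t ≠ k) → Function.Injective (q t) := by
    intro t ht i j hij
    simp only [q] at hij
    split_ifs at hij with h1 h2 h2
    · rw [h1, h2]
    · exact absurd (OnePoint.coe_injective hij) (ht _)
    · exact absurd (OnePoint.coe_injective hij).symm (ht _)
    · exact Fin.ext (Nat.cast_injective (OnePoint.coe_injective hij))
  have hq1 := hq Complex.I (fun k h => by simpa using congrArg Complex.im h)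
  have hq2 := hq (-Complex.I) (fun k h => by simpa using congrArg Complex.im h)
  have same : ∀ t s i, i ≠ a → q t i = q s i := fun t s i hi => by simp [q, hi]
  obtain ⟨g, hg⟩ := act _ hq1
  obtain ⟨k, hk⟩ := act _ hq2
  have agree : ∀ i, i ≠ a ∧ i ≠ σ⁻¹ a → g • q Complex.I i = k • q Complex.I i := by
    rintro i ⟨hi, hi'⟩
    rw [hg, same _ (-Complex.I) i hi, hk]
    exact same _ _ _ fun h => hi' (by rw [← h]; exact (σ.symm_apply_apply i).symm)
  have all := mobius_eq_of_eq_three (hq1.ne huv) (hq1.ne huw) (hq1.ne hvw) (agree u hu) (agree v hv)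
    (agree w hw)
  have e : k • q Complex.I a = k • q (-Complex.I) a := by
    rw [← all, hg, hk]
    exact same _ _ _ ha
  have e' := MulAction.injective k e
  simp only [q, if_true] at e'
  have := congrArg Complex.im (OnePoint.coe_injective e')
  norm_num at this

/-! ### Submanifolds with a holomorphic parametrisation -/

/-- An injective linear map `ℂ^r → ℂ^N` becomes, after a linear change of coordinates in the
target, the inclusion of the first `r` coordinates. -/
theorem exists_straightening {N r : ℕ} (A : (Fin r → ℂ) →L[ℂ] (Fin N → ℂ))
    (hA : Function.Injective A) :
    r ≤ N ∧ ∃ L : (Fin N → ℂ) ≃L[ℂ] (Fin N → ℂ),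
      ∀ y, (∃ u, A u = y) ↔ ∀ i : Fin N, r ≤ i.val → L y i = 0 := by
  have hr : r ≤ N := by
    have := LinearMap.finrank_le_finrank_of_injective (f := A.toLinearMap) hA
    simpa using this
  refine ⟨hr, ?_⟩
  let V : Submodule ℂ (Fin N → ℂ) := LinearMap.range A.toLinearMap
  obtain ⟨W, hVW⟩ := V.exists_isCompl
  have hV : Module.finrank ℂ V = r := by
    rw [LinearMap.finrank_range_of_inj hA]
    simp
  have hW : Module.finrank ℂ W = N - r := by
    have := Submodule.finrank_add_eq_of_isCompl hVW
    simp only [hV, Module.finrank_fintype_fun_eq_card, Fintype.card_fin] at this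
    omega
  let bV := (Module.finBasisOfFinrankEq ℂ V hV)
  let bW := (Module.finBasisOfFinrankEq ℂ W hW)
  let e : Fin r ⊕ Fin (N - r) ≃ Fin N :=
    finSumFinEquiv.trans (finCongr (by omega))
  let b : Module.Basis (Fin N) ℂ (Fin N → ℂ) :=
    ((bV.prod bW).map (V.prodEquivOfIsCompl W hVW)).reindex e
  refine ⟨b.equivFun.toContinuousLinearEquiv, fun y => ?_⟩
  have key : ∀ i : Fin N, r ≤ i.val → ∃ j, i = e (Sum.inr j) := by
    intro i hi
    refine ⟨⟨i.val - r, by omega⟩, ?_⟩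
    ext
    simp [e]
    omega
  have coord : ∀ j, b.equivFun y (e (Sum.inr j)) =
      bW.repr ((V.prodEquivOfIsCompl W hVW).symm y).2 j := by
    intro j
    simp [b]
  have mem : (∃ u, A u = y) ↔ y ∈ V := by
    simp [V]
  rw [mem, ← Submodule.prodEquivOfIsCompl_symm_apply_snd_eq_zero V W hVW]
  constructor
  · intro h i hi
    obtain ⟨j, rfl⟩ := key i hi
    show b.equivFun y _ = 0
    rw [coord, h]
    simp
  · intro h
    apply bW.repr.injective
    ext j
    have := h (e (Sum.inr j)) (by simp [e])
    change b.equivFun y _ = 0 at this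
    rw [coord] at this
    rw [this]
    simp

/-- A set that is holomorphically parametrised by an open subset of `ℂ^r` is an `r`-dimensional
complex submanifold as soon as the parametrisation `f` has a holomorphic left inverse `R` defined
near the image. With `A = Df` and `B = DR`, the map `y ↦ A R(y) + (1 - AB)(y - f(R(y)))` is a local
chart at the points of the image, which it carries into the range of `A`. -/
theorem isComplexSubmanifold_image {N r : ℕ} {U : Set (Fin r → ℂ)} (hU : IsOpen U)
    {f : (Fin r → ℂ) → Fin N → ℂ} {R : (Fin N → ℂ) → Fin r → ℂ}
    (hf : ∀ u ∈ U, ContDiffAt ℂ 1 f u) (hR : ∀ u ∈ U, ContDiffAt ℂ 1 R (f u))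
    (hRf : ∀ u ∈ U, R (f u) = u) (hne : U.Nonempty) : IsComplexSubmanifold (f '' U) r := by
  have deriv : ∀ u ∈ U, (fderiv ℂ R (f u)).comp (fderiv ℂ f u) = ContinuousLinearMap.id ℂ _ := by
    intro u hu
    have h1 := ((hR u hu).differentiableAt one_ne_zero).hasFDerivAt.comp u
      ((hf u hu).differentiableAt one_ne_zero).hasFDerivAt
    have h2 : HasFDerivAt (R ∘ f) (ContinuousLinearMap.id ℂ _) u :=
      (hasFDerivAt_id u).congr_of_eventuallyEq
        (Filter.eventuallyEq_of_mem (hU.mem_nhds hu) fun y hy => hRf y hy)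
    exact h1.unique h2
  have inj : ∀ u ∈ U, Function.Injective (fderiv ℂ f u) := by
    intro u hu
    have h := deriv u hu
    exact Function.LeftInverse.injective (g := fderiv ℂ R (f u)) fun y => by
      simpa using congrArg (fun l => l y) h
  obtain ⟨u₁, hu₁⟩ := hne
  refine ⟨(exists_straightening _ (inj u₁ hu₁)).1, ?_⟩
  rintro _ ⟨u, hu, rfl⟩
  set A := fderiv ℂ f u with hA
  set B := fderiv ℂ R (f u) with hB
  have hBA : ∀ y, B (A y) = y := fun y => by simpa using congrArg (fun l => l y) (deriv u hu)
  obtain ⟨-, L, hL⟩ := exists_straightening A (inj u hu)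
  let Q : (Fin N → ℂ) →L[ℂ] (Fin N → ℂ) := ContinuousLinearMap.id ℂ _ - A.comp B
  let Φ : (Fin N → ℂ) → Fin N → ℂ := fun y => L (A (R y) + Q (y - f (R y)))
  have hfR : ContDiffAt ℂ 1 (fun y => f (R y)) (f u) :=
    ContDiffAt.comp (f u) (by rw [hRf u hu]; exact hf u hu) (hR u hu)
  have hΦ : ContDiffAt ℂ 1 Φ (f u) :=
    L.contDiff.contDiffAt.comp (f u) ((A.contDiff.contDiffAt.comp (f u) (hR u hu)).add
      (Q.contDiff.contDiffAt.comp (f u) (contDiffAt_id.sub hfR)))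
  have hΦ' : HasFDerivAt Φ (L : (Fin N → ℂ) →L[ℂ] (Fin N → ℂ)) (f u) := by
    have dR : HasFDerivAt R B (f u) := ((hR u hu).differentiableAt one_ne_zero).hasFDerivAt
    have df : HasFDerivAt f A (R (f u)) := by
      rw [hRf u hu]
      exact ((hf u hu).differentiableAt one_ne_zero).hasFDerivAt
    have h := L.hasFDerivAt.comp (f u) ((A.hasFDerivAt.comp (f u) dR).add
      (Q.hasFDerivAt.comp (f u) ((hasFDerivAt_id (f u)).sub (df.comp (f u) dR))))
    refine h.congr_fderiv ?_
    ext1 y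
    simp [Q, hBA]
  let Ψ := hΦ.toOpenPartialHomeomorph Φ hΦ' one_ne_zero
  have hsrc : f u ∈ Ψ.source := hΦ.mem_toOpenPartialHomeomorph_source hΦ' one_ne_zero
  have cont : ContinuousAt R (f u) := (hR u hu).continuousAt
  have ev1 : ∀ᶠ y in nhds (f u), R y ∈ U :=
    cont.eventually_mem (by rw [hRf u hu]; exact hU.mem_nhds hu)
  have ev2 : ∀ᶠ y in nhds (f u), f (R y) ∈ Ψ.source :=
    hfR.continuousAt.eventually_mem (by
      show Ψ.source ∈ nhds (f (R (f u)))
      rw [hRf u hu]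
      exact Ψ.open_source.mem_nhds hsrc)
  have ev3 : ∀ᶠ y in nhds (f u), DifferentiableAt ℂ Φ y :=
    (hΦ.eventually (by simp)).mono fun y hy => hy.differentiableAt one_ne_zero
  have ev4 : ∀ᶠ y in nhds (f u), DifferentiableAt ℂ Ψ.symm (Ψ y) := by
    have h1 : ContDiffAt ℂ 1 Ψ.symm (Φ (f u)) := hΦ.to_localInverse hΦ' one_ne_zero
    have h2 : ∀ᶠ w in nhds (Φ (f u)), DifferentiableAt ℂ Ψ.symm w :=
      (h1.eventually (by simp)).mono fun y hy => hy.differentiableAt one_ne_zero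
    exact (Ψ.continuousAt hsrc).eventually h2
  obtain ⟨O, hO, hOo, huO⟩ := eventually_nhds_iff.1 (ev1.and (ev2.and (ev3.and ev4)))
  refine ⟨Ψ.restrOpen O hOo, ⟨hsrc, huO⟩, ?_, ?_, ?_⟩
  · exact fun y hy => (hO y hy.2).2.2.1.differentiableWithinAt
  · intro w hw
    have hw' := (Ψ.restrOpen O hOo).map_target hw
    have e := (Ψ.restrOpen O hOo).right_inv hw
    have := (hO _ hw'.2).2.2.2
    change Ψ ((Ψ.restrOpen O hOo).symm w) = w at e
    rw [e] at this
    exact this.differentiableWithinAt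
  · rintro y ⟨hy, hyO⟩
    obtain ⟨hyU, hyS, -, -⟩ := hO y hyO
    have on : ∀ t ∈ U, Φ (f t) = L (A t) := fun t ht => by simp [Φ, hRf t ht]
    change y ∈ f '' U ↔ ∀ i : Fin N, r ≤ i.val → L (A (R y) + Q (y - f (R y))) i = 0
    rw [← hL]
    constructor
    · rintro ⟨t, ht, rfl⟩
      exact ⟨t, by simp [hRf t ht]⟩
    · rintro ⟨t, ht⟩
      -- The range of `A` meets the kernel of `B`, which contains the range of `Q`, in `0`.
      have hBQ : ∀ w, B (Q w) = 0 := fun w => by simp [Q, hBA]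
      have e1 : t = R y := by
        have := congrArg B ht
        rwa [map_add, hBA, hBA, hBQ, add_zero] at this
      rw [e1, left_eq_add] at ht
      have e2 : Φ y = Φ (f (R y)) := by
        rw [on _ hyU]
        simp only [Φ, ht, add_zero]
      exact ⟨R y, hyU, (Ψ.injOn hy hyS e2).symm⟩

/-! ### Connectedness of parameter spaces -/

/-- An open condition given by the non-vanishing of functions that are polynomial along complex
lines cuts out a connected set: a complex line meets the complement in finitely many points. -/
theorem isPreconnected_of_polynomial_lines {r : ℕ} {ι : Type*} [Finite ι]
    (P : ι → (Fin r → ℂ) → ℂ)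
    (hP : ∀ i x y, ∃ p : Polynomial ℂ, ∀ t : ℂ, P i (x + t • (y - x)) = p.eval t) :
    IsPreconnected {x | ∀ i, P i x ≠ 0} := by
  refine isPreconnected_of_forall_pair fun x hx y hy => ?_
  choose p hp using fun i => hP i x y
  have p0 : ∀ i, p i ≠ 0 := by
    intro i h
    have := hp i 0
    rw [h] at this
    exact hx i (by simpa using this)
  let Z : Set ℂ := ⋃ i, {t | (p i).IsRoot t}
  have hZ : Z.Countable :=
    (Set.finite_iUnion fun i => Polynomial.finite_setOfPred_isRoot (p0 i)).countable
  have hZc : IsPreconnected Zᶜ :=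
    (hZ.isPathConnected_compl_of_one_lt_rank (by simp [Complex.rank_real_complex])).isConnected.2
  have mem : ∀ t, t ∈ Zᶜ ↔ x + t • (y - x) ∈ {x | ∀ i, P i x ≠ 0} := by
    intro t
    simp [Z, hp]
  refine ⟨(fun t : ℂ => x + t • (y - x)) '' Zᶜ, ?_, ⟨0, ?_, by simp⟩, ⟨1, ?_, by simp⟩,
    hZc.image _ (by fun_prop)⟩
  · rintro _ ⟨t, ht, rfl⟩
    exact (mem t).1 ht
  · rw [mem]
    simpa using hx
  · rw [mem]
    simpa using hy

/-! ### Families of configurations -/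

/-- The parameters at which a family of vectors is nondegenerate. -/
def goodParams {n r : ℕ} (v : (Fin r → ℂ) → Fin (n + 1) → Fin 2 → ℂ) : Set (Fin r → ℂ) :=
  {x | Nondegenerate (v x)}

/-- The set of normal forms of the nondegenerate members of a family of configurations. -/
def familyLocus {n r : ℕ} (v : (Fin r → ℂ) → Fin (n + 1) → Fin 2 → ℂ) : Set (Omega n) :=
  {z | ∃ x ∈ goodParams v, Represents z fun i => pt (v x i)}

theorem image_familyLocus {n r : ℕ} (hn : 3 ≤ n) (v : (Fin r → ℂ) → Fin (n + 1) → Fin 2 → ℂ) :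
    Subtype.val '' familyLocus v = (fun x => normalForm hn (v x)) '' goodParams v := by
  ext z
  constructor
  · rintro ⟨z, ⟨x, hx, hz⟩, rfl⟩
    exact ⟨x, hx, (hz.eq_normalForm hn hx).symm⟩
  · rintro ⟨x, hx, rfl⟩
    obtain ⟨z, hz, hz'⟩ := exists_represents_normalForm hn hx
    exact ⟨z, ⟨x, hx, hz'⟩, hz⟩

theorem isOpen_goodParams {n r : ℕ} {v : (Fin r → ℂ) → Fin (n + 1) → Fin 2 → ℂ}
    (hv : ∀ i c, ContDiff ℂ 1 fun x => v x i c) : IsOpen (goodParams v) := by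
  have hc : ∀ i c, Continuous fun x => v x i c := fun i c => (hv i c).continuous
  simp only [goodParams, Nondegenerate, Set.ofPred_forall]
  refine isOpen_iInter_of_finite fun i => isOpen_iInter_of_finite fun j =>
    isOpen_iInter_of_finite fun _ => ?_
  exact isOpen_ne_fun (((hc i 0).mul (hc j 1)).sub ((hc i 1).mul (hc j 0))) continuous_const

theorem isPreconnected_goodParams {n r : ℕ} {v : (Fin r → ℂ) → Fin (n + 1) → Fin 2 → ℂ}
    (hl : ∀ i c x y (t : ℂ), v (x + t • (y - x)) i c = v x i c + t * (v y i c - v x i c)) :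
    IsPreconnected (goodParams v) := by
  have e : goodParams v = {x | ∀ p : {p : Fin (n + 1) × Fin (n + 1) // p.1 ≠ p.2},
      bracket (v x p.1.1) (v x p.1.2) ≠ 0} := by
    ext x
    simp [goodParams, Nondegenerate]
  rw [e]
  refine isPreconnected_of_polynomial_lines
    (fun (p : {p : Fin (n + 1) × Fin (n + 1) // p.1 ≠ p.2}) x => bracket (v x p.1.1) (v x p.1.2))
    fun p x y => ?_
  let l : Fin (n + 1) → Fin 2 → Polynomial ℂ := fun i c =>
    Polynomial.C (v x i c) + Polynomial.X * Polynomial.C (v y i c - v x i c)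
  refine ⟨l p.1.1 0 * l p.1.2 1 - l p.1.1 1 * l p.1.2 0, fun t => ?_⟩
  simp [bracket, hl, l]

theorem contDiffAt_bracket {E : Type*} [NormedAddCommGroup E] [NormedSpace ℂ E]
    {a b : E → Fin 2 → ℂ} {x : E} (ha : ∀ c, ContDiffAt ℂ 1 (fun y => a y c) x)
    (hb : ∀ c, ContDiffAt ℂ 1 (fun y => b y c) x) :
    ContDiffAt ℂ 1 (fun y => bracket (a y) (b y)) x :=
  ((ha 0).mul (hb 1)).sub ((ha 1).mul (hb 0))

theorem contDiffAt_crossRatio {E : Type*} [NormedAddCommGroup E] [NormedSpace ℂ E]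
    {a b c d : E → Fin 2 → ℂ} {x : E} (ha : ∀ k, ContDiffAt ℂ 1 (fun y => a y k) x)
    (hb : ∀ k, ContDiffAt ℂ 1 (fun y => b y k) x) (hc : ∀ k, ContDiffAt ℂ 1 (fun y => c y k) x)
    (hd : ∀ k, ContDiffAt ℂ 1 (fun y => d y k) x) (had : bracket (a x) (d x) ≠ 0)
    (hbc : bracket (b x) (c x) ≠ 0) :
    ContDiffAt ℂ 1 (fun y => crossRatio (a y) (b y) (c y) (d y)) x :=
  ((contDiffAt_bracket hb hd).mul (contDiffAt_bracket ha hc)).div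
    ((contDiffAt_bracket ha hd).mul (contDiffAt_bracket hb hc)) (mul_ne_zero had hbc)

theorem contDiffAt_normalForm {n r : ℕ} (hn : 3 ≤ n)
    {v : (Fin r → ℂ) → Fin (n + 1) → Fin 2 → ℂ} (hv : ∀ i c, ContDiff ℂ 1 fun x => v x i c)
    {x : Fin r → ℂ} (hx : x ∈ goodParams v) :
    ContDiffAt ℂ 1 (fun x => normalForm hn (v x)) x := by
  rw [contDiffAt_pi]
  intro k
  exact contDiffAt_crossRatio (fun c => (hv _ c).contDiffAt) (fun c => (hv _ c).contDiffAt)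
    (fun c => (hv _ c).contDiffAt) (fun c => (hv _ c).contDiffAt) (hx _ _ (by simp))
    (hx _ _ (by simp))

theorem isPreconnected_familyLocus {n r : ℕ} (hn : 3 ≤ n)
    {v : (Fin r → ℂ) → Fin (n + 1) → Fin 2 → ℂ} (hv : ∀ i c, ContDiff ℂ 1 fun x => v x i c)
    (hl : ∀ i c x y (t : ℂ), v (x + t • (y - x)) i c = v x i c + t * (v y i c - v x i c)) :
    IsPreconnected (familyLocus v) := by
  rw [← Topology.IsInducing.subtypeVal.isPreconnected_image, image_familyLocus hn]
  exact (isPreconnected_goodParams hl).image _ fun x hx =>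
    (contDiffAt_normalForm hn hv hx).continuousAt.continuousWithinAt

/-- If three points `a`, `b`, `c` of a family do not move and every parameter is the position of
one of the points, then the parameters are recovered from the cross-ratios with `a`, `b`, `c`, so
the normal forms make up a submanifold. -/
theorem isComplexSubmanifold_familyLocus {n r : ℕ} (hn : 3 ≤ n)
    {v : (Fin r → ℂ) → Fin (n + 1) → Fin 2 → ℂ} (hv : ∀ i c, ContDiff ℂ 1 fun x => v x i c)
    {a b c : Fin (n + 1)} (hab : a ≠ b) (hac : a ≠ c) (hbc : b ≠ c) {wa wb wc : Fin 2 → ℂ}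
    (ha : ∀ x, v x a = wa) (hb : ∀ x, v x b = wb) (hc : ∀ x, v x c = wc)
    {J : Fin r → Fin (n + 1)} (hJa : ∀ i, a ≠ J i) (hJ : ∀ x i, v x (J i) = ![x i, 1])
    (hne : (familyLocus v).Nonempty) :
    IsComplexSubmanifold (Subtype.val '' familyLocus v) r := by
  rw [image_familyLocus hn]
  let cr : (Fin (n - 2) → ℂ) → Fin r → ℂ := fun z i =>
    crossRatio (markingVec z a) (markingVec z b) (markingVec z c) (markingVec z (J i))
  let d : (Fin (n - 2) → ℂ) → Fin r → Fin 2 → ℂ := fun z i k =>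
    bracket wa wc * wb k - cr z i * bracket wb wc * wa k
  -- The inverse of the Möbius transformation `d ↦ crossRatio wa wb wc d`, in coordinates.
  have inv : ∀ x ∈ goodParams v, ∀ i, ∃ l : ℂ, l ≠ 0 ∧
      ∀ k, d (normalForm hn (v x)) i k = l * ![x i, 1] k := by
    intro x hx i
    obtain ⟨z, hz, hz'⟩ := exists_represents_normalForm hn hx
    have e : cr (normalForm hn (v x)) i = crossRatio wa wb wc ![x i, 1] := by
      rw [← hz, ← ha x, ← hb x, ← hc x, ← hJ x]
      exact hz'.crossRatio_eq hx hab hac hbc (hJa i)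
    have h1 : bracket wa wb ≠ 0 := by
      rw [← ha x, ← hb x]
      exact hx _ _ hab
    have h2 : bracket wa wc ≠ 0 := by
      rw [← ha x, ← hc x]
      exact hx _ _ hac
    have h3 : bracket wb wc ≠ 0 := by
      rw [← hb x, ← hc x]
      exact hx _ _ hbc
    have h4 : bracket wa ![x i, 1] ≠ 0 := by
      rw [← ha x, ← hJ x]
      exact hx _ _ (hJa i)
    refine ⟨bracket wa wc * bracket wa wb / bracket wa ![x i, 1],
      div_ne_zero (mul_ne_zero h2 h1) h4, fun k => ?_⟩
    simp only [d, e, crossRatio]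
    have e2 : bracket wb ![x i, 1] * bracket wa wc / (bracket wa ![x i, 1] * bracket wb wc) *
        bracket wb wc = bracket wb ![x i, 1] * bracket wa wc / bracket wa ![x i, 1] := by
      field_simp
    rw [e2]
    have e3 : bracket wa ![x i, 1] * wb k - bracket wb ![x i, 1] * wa k =
        bracket wa wb * ![x i, 1] k := by
      fin_cases k <;> simp [bracket] <;> ring
    rw [div_mul_eq_mul_div, div_mul_eq_mul_div, eq_div_iff h4, sub_mul, div_mul_cancel₀ _ h4]
    linear_combination bracket wa wc * e3
  refine isComplexSubmanifold_image (R := fun z i => d z i 0 / d z i 1) (isOpen_goodParams hv)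
    (fun x hx => contDiffAt_normalForm hn hv hx) ?_ ?_ ?_
  · intro x hx
    rw [contDiffAt_pi]
    intro i
    obtain ⟨z, hz, -⟩ := exists_represents_normalForm hn hx
    have hcr : ContDiffAt ℂ 1 (fun z => cr z i) (normalForm hn (v x)) := by
      refine contDiffAt_crossRatio (fun k => (contDiff_markingVec _ k).contDiffAt)
        (fun k => (contDiff_markingVec _ k).contDiffAt)
        (fun k => (contDiff_markingVec _ k).contDiffAt)
        (fun k => (contDiff_markingVec _ k).contDiffAt) ?_ ?_
      · rw [← hz]
        exact bracket_markingVec_ne_zero z (hJa i)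
      · rw [← hz]
        exact bracket_markingVec_ne_zero z hbc
    have hd : ∀ k, ContDiffAt ℂ 1 (fun z => d z i k) (normalForm hn (v x)) := fun k =>
      contDiffAt_const.sub ((hcr.mul contDiffAt_const).mul contDiffAt_const)
    obtain ⟨l, hl, hl'⟩ := inv x hx i
    exact (hd 0).div (hd 1) (by simpa [hl'] using hl)
  · intro x hx
    funext i
    obtain ⟨l, hl, hl'⟩ := inv x hx i
    simp only [hl']
    simp [hl]
  · obtain ⟨z, x, hx, -⟩ := hne
    exact ⟨x, hx⟩

/-! ### Permutations with cycles of a single length -/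

/-- Translation by `l` in each of `k` cyclic groups of order `m`, fixing `e` further points: a model
for the permutations all of whose cycles have length `m` or `1`. -/
def shift {m k e : ℕ} (l : ZMod m) (p : (ZMod m × Fin k) ⊕ Fin e) : (ZMod m × Fin k) ⊕ Fin e :=
  Sum.map (fun p => (p.1 + l, p.2)) id p

theorem shift_shift {m k e : ℕ} (l l' : ZMod m) (p : (ZMod m × Fin k) ⊕ Fin e) :
    shift l (shift l' p) = shift (l' + l) p := by
  rcases p with ⟨a, o⟩ | i <;> simp [shift, add_assoc]

theorem pow_eq_pow_of_modEq {X : Type*} {σ : Equiv.Perm X} {m : ℕ} {i : X}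
    (h : (σ ^ m) i = i) {a b : ℕ} (hab : a ≡ b [MOD m]) : (σ ^ a) i = (σ ^ b) i := by
  have key : ∀ a : ℕ, (σ ^ a) i = (σ ^ (a % m)) i := by
    intro a
    conv_lhs => rw [← Nat.mod_add_div a m, pow_add, Equiv.Perm.mul_apply, pow_mul]
    rw [Equiv.Perm.pow_apply_eq_self_of_apply_eq_self h]
  rw [key a, key b, hab]

theorem modEq_of_pow_eq_pow {X : Type*} {σ : Equiv.Perm X} {m : ℕ} {i : X}
    (h : ∀ l : ℕ, (σ ^ l) i = i ↔ m ∣ l) {a b : ℕ} (hab : (σ ^ a) i = (σ ^ b) i) :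
    a ≡ b [MOD m] := by
  wlog hle : a ≤ b generalizing a b
  · exact (this hab.symm (by omega)).symm
  rw [Nat.modEq_iff_dvd' hle, ← h]
  obtain ⟨c, rfl⟩ := Nat.exists_eq_add_of_le hle
  rw [pow_add, Equiv.Perm.mul_apply] at hab
  rw [Nat.add_sub_cancel_left]
  exact ((σ ^ a).injective hab).symm

theorem exists_cycle_coordinates {X : Type*} [Finite X] (σ : Equiv.Perm X) (m : ℕ) [NeZero m]
    (h : ∀ i, σ i = i ∨ ∀ l : ℕ, (σ ^ l) i = i ↔ m ∣ l) :
    ∃ k e : ℕ, ∃ E : X ≃ (ZMod m × Fin k) ⊕ Fin e, ∀ i, E (σ i) = shift 1 (E i) := by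
  classical
  let O := {q : Quotient (Equiv.Perm.SameCycle.setoid σ) // σ q.out ≠ q.out}
  let F := {i : X // σ i = i}
  have per : ∀ o : O, ∀ l : ℕ, (σ ^ l) o.1.out = o.1.out ↔ m ∣ l := fun o =>
    (h _).resolve_left o.2
  let Ψ : (ZMod m × O) ⊕ F → X := Sum.elim (fun p => (σ ^ p.1.val) p.2.1.out) Subtype.val
  have same : ∀ (o : O) (l : ℕ), σ.SameCycle o.1.out ((σ ^ l) o.1.out) := fun o l =>
    ⟨l, by simp⟩
  have cls : ∀ (o : O) (l : ℕ),
      (Quotient.mk (Equiv.Perm.SameCycle.setoid σ) ((σ ^ l) o.1.out)) = o.1 := fun o l =>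
    (Quotient.sound (s := Equiv.Perm.SameCycle.setoid σ) (same o l)).symm.trans (Quotient.out_eq _)
  have moved : ∀ (o : O) (l : ℕ), σ ((σ ^ l) o.1.out) ≠ (σ ^ l) o.1.out := fun o l e =>
    o.2 ((same o l).apply_eq_self_iff.2 e)
  have hΨ : Function.Bijective Ψ := by
    constructor
    · rintro (⟨a, o⟩ | i) (⟨b, o'⟩ | j) hij
      · simp only [Ψ, Sum.elim_inl] at hij
        have e : o = o' := by
          apply Subtype.ext
          rw [← cls o a.val, hij, cls]
        subst e
        have := modEq_of_pow_eq_pow (per o) hij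
        have : a = b := by
          rw [← ZMod.natCast_zmod_val a, ← ZMod.natCast_zmod_val b]
          exact (ZMod.natCast_eq_natCast_iff _ _ _).2 this
        rw [this]
      · simp only [Ψ, Sum.elim_inl, Sum.elim_inr] at hij
        exact absurd (by rw [hij]; exact j.2) (moved o a.val)
      · simp only [Ψ, Sum.elim_inl, Sum.elim_inr] at hij
        exact absurd (by rw [← hij]; exact i.2) (moved o' b.val)
      · simp only [Ψ, Sum.elim_inr] at hij
        rw [Subtype.ext hij]
    · intro i
      by_cases hi : σ i = i
      · exact ⟨Sum.inr ⟨i, hi⟩, rfl⟩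
      · have hs : σ.SameCycle (Quotient.mk (Equiv.Perm.SameCycle.setoid σ) i).out i :=
          Quotient.exact (s := Equiv.Perm.SameCycle.setoid σ) (Quotient.out_eq _)
        let o : O := ⟨Quotient.mk _ i, fun e => hi (hs.apply_eq_self_iff.1 e)⟩
        obtain ⟨l, hl⟩ := hs.exists_nat_pow_eq
        refine ⟨Sum.inl ((l : ZMod m), o), ?_⟩
        simp only [Ψ, Sum.elim_inl]
        rw [← hl]
        refine pow_eq_pow_of_modEq ((per o m).2 dvd_rfl) ?_
        rw [ZMod.val_natCast]
        exact Nat.mod_modEq _ _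
  have : Finite O := Subtype.finite
  have : Finite F := Subtype.finite
  have eqv : ∀ p : (ZMod m × O) ⊕ F,
      Ψ (Sum.map (fun p => (p.1 + 1, p.2)) id p) = σ (Ψ p) := by
    rintro (⟨a, o⟩ | i)
    · simp only [Ψ, Sum.map_inl, Sum.elim_inl]
      rw [← Equiv.Perm.mul_apply, ← pow_succ']
      refine pow_eq_pow_of_modEq ((per o m).2 dvd_rfl) ?_
      rw [← ZMod.natCast_eq_natCast_iff]
      simp
    · exact i.2.symm
  let eO : O ≃ Fin (Nat.card O) := Finite.equivFin O
  let eF : F ≃ Fin (Nat.card F) := Finite.equivFin F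
  let Ψe := Equiv.ofBijective Ψ hΨ
  refine ⟨Nat.card O, Nat.card F,
    Ψe.symm.trans (Equiv.sumCongr ((Equiv.refl _).prodCongr eO) eF), fun i => ?_⟩
  obtain ⟨p, rfl⟩ := Ψe.surjective i
  have e : σ (Ψe p) = Ψe (Sum.map (fun p => (p.1 + 1, p.2)) id p) := (eqv p).symm
  rw [e, Equiv.trans_apply, Equiv.trans_apply, Equiv.symm_apply_apply, Equiv.symm_apply_apply]
  rcases p with ⟨a, o⟩ | i <;> rfl

theorem coordinates_pow {X : Type*} {σ : Equiv.Perm X} {m k e : ℕ}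
    {E : X ≃ (ZMod m × Fin k) ⊕ Fin e} (hE : ∀ i, E (σ i) = shift 1 (E i)) (l : ℕ) (i : X) :
    E ((σ ^ l) i) = shift (l : ZMod m) (E i) := by
  induction l with
  | zero => rcases h : E i with ⟨a, o⟩ | j <;> simp [shift, h]
  | succ l ih => rw [pow_succ', Equiv.Perm.mul_apply, hE, ih, shift_shift, Nat.cast_succ]

theorem count_cycleType_of_coordinates {X : Type*} [Fintype X] [DecidableEq X]
    {σ : Equiv.Perm X} {m k e : ℕ} (hm : 2 ≤ m) {E : X ≃ (ZMod m × Fin k) ⊕ Fin e}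
    (hE : ∀ i, E (σ i) = shift 1 (E i)) : σ.cycleType.count m = k := by
  have : NeZero m := ⟨by omega⟩
  have : Fact (1 < m) := ⟨hm⟩
  have hpow : σ ^ m = 1 := by
    ext i
    apply E.injective
    rw [coordinates_pow hE]
    rcases h : E i with ⟨a, o⟩ | j <;> simp [shift, h]
  have hall : ∀ c ∈ σ.cycleType, c = m := by
    intro c hc
    refine Nat.dvd_antisymm
      ((Equiv.Perm.dvd_of_mem_cycleType hc).trans (orderOf_dvd_of_pow_eq_one hpow)) ?_
    obtain ⟨γ, τ, rfl, hd, hγ, rfl⟩ := Equiv.Perm.mem_cycleType_iff.1 hc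
    obtain ⟨i, hi⟩ := hγ.nonempty_support
    have hτ : τ i = i := by
      have := hd i
      rw [Equiv.Perm.mem_support] at hi
      tauto
    have e1 : ((γ * τ) ^ γ.support.card) i = i := by
      rw [← hγ.orderOf, hd.commute.mul_pow, pow_orderOf_eq_one, one_mul]
      exact Equiv.Perm.pow_apply_eq_self_of_apply_eq_self hτ _
    have e2 : (γ * τ) i ≠ i := by
      rw [Equiv.Perm.mul_apply, hτ]
      exact Equiv.Perm.mem_support.1 hi
    have e3 := coordinates_pow hE γ.support.card i
    have e4 := hE i
    rw [e1] at e3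
    rcases hEi : E i with ⟨a, o⟩ | j
    · rw [hEi] at e3
      simp only [shift, Sum.map_inl, Sum.inl.injEq, Prod.mk.injEq, and_true, left_eq_add] at e3
      exact (ZMod.natCast_eq_zero_iff _ _).1 e3
    · rw [hEi] at e4
      exact absurd (E.injective (e4.trans hEi.symm)) e2
  have hsupp : σ.support =
      Finset.univ.map ((Function.Embedding.inl (β := Fin e)).trans E.symm.toEmbedding) := by
    ext i
    rw [Equiv.Perm.mem_support, ← E.injective.ne_iff, hE]
    simp only [Finset.mem_map, Finset.mem_univ, true_and, Function.Embedding.trans_apply]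
    obtain ⟨p, rfl⟩ := E.symm.surjective i
    rw [Equiv.apply_symm_apply]
    simp only [Equiv.coe_toEmbedding, E.symm.injective.eq_iff]
    rcases p with ⟨a, o⟩ | i <;> simp [shift]
  have hrep := Multiset.eq_replicate_card.2 hall
  have hsum := σ.sum_cycleType
  rw [hrep, Multiset.sum_replicate, hsupp, Finset.card_map, Finset.card_univ, Fintype.card_prod,
    ZMod.card, Fintype.card_fin, smul_eq_mul, mul_comm] at hsum
  rw [hrep, Multiset.count_replicate_self]
  exact Nat.eq_of_mul_eq_mul_left (by omega) hsum

theorem card_of_coordinates {N m k e : ℕ} [NeZero m] (E : Fin N ≃ (ZMod m × Fin k) ⊕ Fin e) :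
    N = m * k + e := by
  have := Fintype.card_congr E
  simpa [ZMod.card] using this

/-! ### Diagonalisation of Möbius transformations of finite order -/

/-- Multiplication by `ζ` on the Riemann sphere, fixing `∞`. -/
def dil (ζ : ℂ) : OnePoint ℂ → OnePoint ℂ := OnePoint.map (ζ * ·)

theorem dil_infty (ζ : ℂ) : dil ζ ∞ = ∞ := rfl

theorem dil_coe (ζ x : ℂ) : dil ζ (x : OnePoint ℂ) = ((ζ * x : ℂ) : OnePoint ℂ) := rfl

theorem dil_dil (a b : ℂ) (p : OnePoint ℂ) : dil a (dil b p) = dil (a * b) p := by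
  induction p using OnePoint.rec with
  | infty => rfl
  | coe x => rw [dil_coe, dil_coe, dil_coe, mul_assoc]

theorem dil_one (p : OnePoint ℂ) : dil 1 p = p := by
  induction p using OnePoint.rec with
  | infty => rfl
  | coe x => rw [dil_coe, one_mul]

theorem dil_pt (ζ : ℂ) (v : Fin 2 → ℂ) : dil ζ (pt v) = pt ![ζ * v 0, v 1] := by
  by_cases h : v 1 = 0
  · rw [pt_eq_infty_iff.2 h, dil_infty]
    exact (pt_eq_infty_iff.2 (by simpa using h)).symm
  · rw [pt_of_ne h, pt_of_ne (by simpa using h), dil_coe]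
    simp [mul_div_assoc]

theorem dil_eq_self_iff {ζ : ℂ} (hζ : ζ ≠ 1) (p : OnePoint ℂ) :
    dil ζ p = p ↔ p = ∞ ∨ p = ((0 : ℂ) : OnePoint ℂ) := by
  induction p using OnePoint.rec with
  | infty => simp [dil_infty]
  | coe x =>
    simp only [dil_coe, OnePoint.coe_ne_infty, false_or, OnePoint.coe_eq_coe]
    constructor
    · intro h
      have : (ζ - 1) * x = 0 := by linear_combination h
      exact (mul_eq_zero.1 this).resolve_left (sub_ne_zero.2 hζ)
    · rintro rfl
      exact mul_zero ζ

theorem exists_affine (a b : ℂ) (ha : a ≠ 0) :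
    ∃ g : GL (Fin 2) ℂ, g • (∞ : OnePoint ℂ) = ∞ ∧
      ∀ x : ℂ, g • (x : OnePoint ℂ) = ((a * x + b : ℂ) : OnePoint ℂ) := by
  refine ⟨Matrix.GeneralLinearGroup.mkOfDetNeZero !![a, b; 0, 1]
    (by simpa [Matrix.det_fin_two] using ha), ?_, fun x => ?_⟩
  · rw [smul_infty_eq_ite]
    simp [Matrix.GeneralLinearGroup.mkOfDetNeZero]
  · rw [smul_some_eq_ite]
    simp [Matrix.GeneralLinearGroup.mkOfDetNeZero]

theorem exists_smul_eq_dil {ζ : ℂ} (hζ : ζ ≠ 0) :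
    ∃ g : GL (Fin 2) ℂ, ∀ p : OnePoint ℂ, g • p = dil ζ p := by
  obtain ⟨g, g0, g1⟩ := exists_affine ζ 0 hζ
  refine ⟨g, fun p => ?_⟩
  induction p using OnePoint.rec with
  | infty => exact g0
  | coe x => rw [g1, add_zero, dil_coe]

theorem exists_smul_eq_infty (P : OnePoint ℂ) : ∃ g : GL (Fin 2) ℂ, g • P = ∞ := by
  induction P using OnePoint.rec with
  | infty => exact ⟨1, one_smul _ _⟩
  | coe x =>
    obtain ⟨g, hg, -⟩ := exists_mobius (a := (x : OnePoint ℂ)) (b := ∞)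
      (c := ((x + 1 : ℂ) : OnePoint ℂ)) (OnePoint.coe_ne_infty _) (by simp)
      (OnePoint.infty_ne_coe _)
    exact ⟨g, hg⟩

theorem exists_smul_eq_self (g : GL (Fin 2) ℂ) : ∃ P : OnePoint ℂ, g • P = P := by
  by_cases hc : g 1 0 = 0
  · exact ⟨∞, smul_infty_eq_self_iff.2 hc⟩
  · obtain ⟨s, hs⟩ := IsAlgClosed.exists_eq_mul_self (discrim (g 1 0) (g 1 1 - g 0 0) (-g 0 1))
    obtain ⟨x, hx⟩ := exists_quadratic_eq_zero hc ⟨s, hs⟩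
    refine ⟨x, ?_⟩
    rw [← Matrix.GeneralLinearGroup.fixpointPolynomial_aeval_eq_zero_iff]
    simp only [Matrix.GeneralLinearGroup.fixpointPolynomial, map_sub, map_mul, map_add,
      Polynomial.aeval_X_pow, Polynomial.aeval_C, Polynomial.aeval_X,
      Algebra.algebraMap_self_apply]
    linear_combination hx

/-- A non-trivial Möbius transformation of finite order is conjugate to a multiplication, by a
conjugation that sends a prescribed fixed point to `∞`. -/
theorem exists_conj_dil {g : GL (Fin 2) ℂ} {P : OnePoint ℂ} (hP : g • P = P) {m : ℕ} (hm : m ≠ 0)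
    (hgm : ∀ p : OnePoint ℂ, g ^ m • p = p) (hg : ∃ p : OnePoint ℂ, g • p ≠ p) :
    ∃ (h : GL (Fin 2) ℂ) (ζ : ℂ), ζ ≠ 0 ∧ h • P = ∞ ∧
      ∀ p : OnePoint ℂ, h • g • p = dil ζ (h • p) := by
  obtain ⟨h₁, hh₁⟩ := exists_smul_eq_infty P
  let k : GL (Fin 2) ℂ := h₁ * g * h₁⁻¹
  have hk : ∀ p : OnePoint ℂ, h₁ • g • p = k • h₁ • p := fun p => by
    simp [k, mul_smul]
  have hk' : k • (∞ : OnePoint ℂ) = ∞ := by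
    rw [← hh₁, ← hk, hP]
  have hkm : ∀ p : OnePoint ℂ, k ^ m • p = p := by
    intro p
    simp only [k, conj_pow, mul_smul, hgm, smul_inv_smul]
  have hc := smul_infty_eq_self_iff.1 hk'
  have hdet := k.det_ne_zero
  rw [Matrix.det_fin_two, hc, mul_zero, sub_zero] at hdet
  have hd : k 1 1 ≠ 0 := right_ne_zero_of_mul hdet
  have ha : k 0 0 ≠ 0 := left_ne_zero_of_mul hdet
  set α := k 0 0 / k 1 1 with hα
  set β := k 0 1 / k 1 1 with hβ
  have act : ∀ x : ℂ, k • (x : OnePoint ℂ) = ((α * x + β : ℂ) : OnePoint ℂ) := by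
    intro x
    rw [smul_some_eq_ite]
    simp only [hc, zero_mul, zero_add, hd, if_false, OnePoint.coe_eq_coe, hα, hβ]
    field_simp
  have hα0 : α ≠ 0 := div_ne_zero ha hd
  by_cases h1 : α = 1
  · exfalso
    have it : ∀ l : ℕ, k ^ l • ((0 : ℂ) : OnePoint ℂ) = ((l * β : ℂ) : OnePoint ℂ) := by
      intro l
      induction l with
      | zero => simp
      | succ l ih =>
        rw [pow_succ', mul_smul, ih, act, h1]
        push_cast
        ring_nf
    have hβ0 : β = 0 := by
      have := it m
      rw [hkm, OnePoint.coe_eq_coe] at this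
      simpa [hm] using this.symm
    obtain ⟨p, hp⟩ := hg
    have triv : ∀ p : OnePoint ℂ, k • p = p := by
      intro p
      induction p using OnePoint.rec with
      | infty => exact hk'
      | coe x => rw [act, h1, hβ0, one_mul, add_zero]
    exact hp (MulAction.injective h₁ ((hk p).trans (triv _)))
  · have h1' : 1 - α ≠ 0 := sub_ne_zero.2 (Ne.symm h1)
    obtain ⟨h₂, e0, e1⟩ := exists_affine 1 (-(β / (1 - α))) one_ne_zero
    refine ⟨h₂ * h₁, α, hα0, by rw [mul_smul, hh₁, e0], fun p => ?_⟩
    rw [mul_smul, mul_smul, hk]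
    generalize h₁ • p = y
    induction y using OnePoint.rec with
    | infty => rw [hk', e0, dil_infty]
    | coe y =>
      rw [act, e1, e1, dil_coe, OnePoint.coe_eq_coe]
      field_simp
      ring

/-! ### Eigenloci -/

/-- The normal forms of the configurations on which `σ` acts as multiplication by `ζ`, up to a
Möbius transformation. The points with label in `A` are required to sit at the fixed point `∞` of
the multiplication: without that condition `ζ` could not be told from `ζ⁻¹`. -/
def eigenLocus {n : ℕ} (σ : Equiv.Perm (Fin (n + 1))) (A : Set (Fin (n + 1))) (ζ : ℂ) :
    Set (Omega n) :=
  {z | ∃ q, Represents z q ∧ (∀ i, q (σ i) = dil ζ (q i)) ∧ ∀ i ∈ A, q i = ∞}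

theorem eq_dil_pow {X : Type*} {σ : Equiv.Perm X} {ζ : ℂ} {q : X → OnePoint ℂ}
    (hq : ∀ i, q (σ i) = dil ζ (q i)) (l : ℕ) (i : X) : q ((σ ^ l) i) = dil (ζ ^ l) (q i) := by
  induction l with
  | zero => simp [dil_one]
  | succ l ih => rw [pow_succ', Equiv.Perm.mul_apply, hq, ih, dil_dil, pow_succ']

theorem exists_ne_infty_ne_zero {n : ℕ} (hn : 3 ≤ n) {q : Fin (n + 1) → OnePoint ℂ}
    (hq : Function.Injective q) : ∃ i, q i ≠ ∞ ∧ q i ≠ ((0 : ℂ) : OnePoint ℂ) := by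
  by_contra! h
  have h' : ∀ i, q i = ∞ ∨ q i = ((0 : ℂ) : OnePoint ℂ) := fun i => or_iff_not_imp_left.2 (h i)
  have ne : ∀ (a b : ℕ) (ha : a < n + 1) (hb : b < n + 1), a ≠ b → q ⟨a, ha⟩ ≠ q ⟨b, hb⟩ :=
    fun a b ha hb hab e => hab (by simpa using hq e)
  have h01 := ne 0 1 (by omega) (by omega) (by simp)
  have h02 := ne 0 2 (by omega) (by omega) (by simp)
  have h12 := ne 1 2 (by omega) (by omega) (by simp)
  rcases h' ⟨0, by omega⟩ with h0 | h0 <;> rcases h' ⟨1, by omega⟩ with h1 | h1 <;>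
    rcases h' ⟨2, by omega⟩ with h2 | h2 <;> rw [h0, h1] at h01 <;> rw [h0, h2] at h02 <;>
    rw [h1, h2] at h12 <;> simp at h01 h02 h12

theorem eigenLocus_subset_Fix {n : ℕ} (hn : 3 ≤ n) (σ : Equiv.Perm (Fin (n + 1)))
    (A : Set (Fin (n + 1))) {ζ : ℂ} (hζ : ζ ≠ 0) : eigenLocus σ A ζ ⊆ Fix (Theta n hn σ) := by
  rintro z ⟨q, ⟨h, hh⟩, hq, -⟩
  obtain ⟨d, hd⟩ := exists_smul_eq_dil hζ
  refine (Theta_apply_eq_iff hn σ z z).2 ⟨h⁻¹ * d * h, fun i => ?_⟩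
  rw [mul_smul, mul_smul, hh, hd, ← hq, ← hh, inv_smul_smul]

theorem exists_mem_eigenLocus {n : ℕ} (hn : 3 ≤ n) {σ : Equiv.Perm (Fin (n + 1))} (hσ : σ ≠ 1)
    {z : Omega n} (hz : z ∈ Fix (Theta n hn σ)) {A : Set (Fin (n + 1))} (hA : A.Subsingleton)
    (hAσ : ∀ i ∈ A, σ i = i) :
    ∃ ζ, IsPrimitiveRoot ζ (orderOf σ) ∧ z ∈ eigenLocus σ A ζ := by
  obtain ⟨g, hg⟩ := (Theta_apply_eq_iff hn σ z z).1 hz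
  have hinj := marking_injective z
  have hpow : ∀ (l : ℕ) i, g ^ l • marking z.1 i = marking z.1 ((σ ^ l) i) := by
    intro l i
    induction l with
    | zero => simp
    | succ l ih => rw [pow_succ', mul_smul, ih, hg, pow_succ', Equiv.Perm.mul_apply]
  have hgm : ∀ p : OnePoint ℂ, g ^ orderOf σ • p = p := by
    intro p
    have fixes : ∀ i, g ^ orderOf σ • marking z.1 i = (1 : GL (Fin 2) ℂ) • marking z.1 i := by
      intro i
      rw [hpow, pow_orderOf_eq_one, one_smul]
      rfl
    have := mobius_eq_of_eq_three (hinj.ne (a₁ := (⟨0, by omega⟩ : Fin (n + 1)))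
      (a₂ := ⟨1, by omega⟩) (by simp)) (hinj.ne (a₁ := (⟨0, by omega⟩ : Fin (n + 1)))
      (a₂ := ⟨2, by omega⟩) (by simp)) (hinj.ne (a₁ := (⟨1, by omega⟩ : Fin (n + 1)))
      (a₂ := ⟨2, by omega⟩) (by simp)) (fixes _) (fixes _) (fixes _) p
    rwa [one_smul] at this
  have hg1 : ∃ p : OnePoint ℂ, g • p ≠ p := by
    by_contra! h
    exact hσ (Equiv.ext fun i => hinj (by rw [← hg, h]; rfl))
  have hP : ∃ P : OnePoint ℂ, g • P = P ∧ ∀ i ∈ A, marking z.1 i = P := by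
    rcases A.eq_empty_or_nonempty with rfl | ⟨a, ha⟩
    · obtain ⟨P, hP⟩ := exists_smul_eq_self g
      exact ⟨P, hP, by simp⟩
    · exact ⟨marking z.1 a, by rw [hg, hAσ a ha], fun i hi => by rw [hA hi ha]⟩
  obtain ⟨P, hgP, hPA⟩ := hP
  obtain ⟨h, ζ, hζ, hhP, hh⟩ := exists_conj_dil hgP (orderOf_pos σ).ne' hgm hg1
  have hq : ∀ i, h • marking z.1 (σ i) = dil ζ (h • marking z.1 i) := fun i => by rw [← hg, hh]
  have hq' : Function.Injective fun i => h • marking z.1 i := (MulAction.injective h).comp hinj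
  have hql := eq_dil_pow (q := fun i => h • marking z.1 i) hq
  refine ⟨ζ, ⟨?_, fun l hl => orderOf_dvd_of_pow_eq_one (Equiv.ext fun i => hq' ?_)⟩,
    _, ⟨h, fun i => rfl⟩, hq, fun i hi => by rw [hPA i hi, hhP]⟩
  · by_contra hne
    obtain ⟨i, hi, hi'⟩ := exists_ne_infty_ne_zero hn hq'
    have := hql (orderOf σ) i
    rw [pow_orderOf_eq_one] at this
    exact ((dil_eq_self_iff hne _).1 this.symm).elim hi hi'
  · refine (hql l i).trans ?_
    rw [hl, dil_one]
    rfl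

theorem period_of_dil {X : Type*} {σ : Equiv.Perm X} {m : ℕ} (hm : 2 ≤ m) {ζ : ℂ}
    (hζ : IsPrimitiveRoot ζ m) {q : X → OnePoint ℂ} (hinj : Function.Injective q)
    (hq : ∀ i, q (σ i) = dil ζ (q i)) (i : X) :
    σ i = i ∨ ∀ l : ℕ, (σ ^ l) i = i ↔ m ∣ l := by
  rw [or_iff_not_imp_left]
  intro hi l
  have hζ1 : ζ ≠ 1 := hζ.ne_one (by omega)
  have hqi : ¬(q i = ∞ ∨ q i = ((0 : ℂ) : OnePoint ℂ)) := by
    rw [← dil_eq_self_iff hζ1, ← hq]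
    exact hinj.ne hi
  rw [← hinj.eq_iff, eq_dil_pow hq, ← hζ.pow_eq_one_iff_dvd]
  constructor
  · intro h
    by_contra hne
    exact hqi ((dil_eq_self_iff hne _).1 h)
  · intro h
    rw [h, dil_one]

theorem fixed_iff_of_dil {X : Type*} {σ : Equiv.Perm X} {ζ : ℂ} (hζ : ζ ≠ 1)
    {q : X → OnePoint ℂ} (hinj : Function.Injective q) (hq : ∀ i, q (σ i) = dil ζ (q i)) (i : X) :
    σ i = i ↔ q i = ∞ ∨ q i = ((0 : ℂ) : OnePoint ℂ) := by
  rw [← dil_eq_self_iff hζ, ← hq, hinj.eq_iff]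

/-! ### The diagonal family -/

/-- Homogeneous coordinates of the configurations, indexed by the points of `k` cycles of length
`m` and at most two fixed points, that are permuted cyclically by the multiplication by `ζ`; the
base point of the first cycle is at `1` and those of the other ones are the parameters. -/
def diagVec {m r e : ℕ} (ζ : ℂ) (x : Fin r → ℂ) : (ZMod m × Fin (r + 1)) ⊕ Fin e → Fin 2 → ℂ :=
  Sum.elim (fun p => ![ζ ^ p.1.val * Fin.cons (α := fun _ => ℂ) 1 x p.2, 1])
    fun t => if t.val = 0 then ![1, 0] else ![0, 1]

theorem diagVec_ne_zero {m r e : ℕ} (ζ : ℂ) (x : Fin r → ℂ)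
    (p : (ZMod m × Fin (r + 1)) ⊕ Fin e) : diagVec ζ x p ≠ 0 := by
  intro h
  have h0 := congrFun h 0
  have h1 := congrFun h 1
  revert h0 h1
  rcases p with p | t
  · simp [diagVec]
  · simp only [diagVec, Sum.elim_inr]
    split_ifs <;> simp

theorem pow_val_add_one {m : ℕ} (hm : 2 ≤ m) {ζ : ℂ} (hζ : ζ ^ m = 1) (l : ZMod m) :
    ζ ^ (l + 1).val = ζ * ζ ^ l.val := by
  have : Fact (1 < m) := ⟨hm⟩
  rw [ZMod.val_add, ZMod.val_one, ← pow_eq_pow_mod _ hζ, pow_succ']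

theorem dil_diagVec {m r e : ℕ} (hm : 2 ≤ m) {ζ : ℂ} (hζ : ζ ^ m = 1) (x : Fin r → ℂ)
    (p : (ZMod m × Fin (r + 1)) ⊕ Fin e) :
    dil ζ (pt (diagVec ζ x p)) = pt (diagVec ζ x (shift 1 p)) := by
  rcases p with ⟨l, j⟩ | t
  · rw [dil_pt]
    simp [diagVec, shift, pow_val_add_one hm hζ, mul_assoc]
  · simp only [diagVec, shift, Sum.map_inr, Sum.elim_inr, id]
    split_ifs
    · simp [pt, dil_infty]
    · simp [pt, dil_coe]

theorem contDiff_diagVec {m r e : ℕ} (ζ : ℂ) (p : (ZMod m × Fin (r + 1)) ⊕ Fin e) (c : Fin 2) :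
    ContDiff ℂ 1 fun x : Fin r → ℂ => diagVec ζ x p c := by
  rcases p with ⟨l, j⟩ | t
  · refine Fin.cases ?_ (fun j => ?_) j <;> fin_cases c <;> simp [diagVec] <;> fun_prop
  · exact contDiff_const

theorem diagVec_line {m r e : ℕ} (ζ : ℂ) (p : (ZMod m × Fin (r + 1)) ⊕ Fin e) (c : Fin 2)
    (x y : Fin r → ℂ) (t : ℂ) :
    diagVec ζ (x + t • (y - x)) p c =
      diagVec ζ x p c + t * (diagVec ζ y p c - diagVec ζ x p c) := by
  rcases p with ⟨l, j⟩ | s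
  · refine Fin.cases ?_ (fun j => ?_) j <;> fin_cases c <;> simp [diagVec]
    ring
  · simp [diagVec]

/-- The label of the first fixed point, if there is one. -/
def markedLabels {X : Type*} {m k e : ℕ} (E : X ≃ (ZMod m × Fin k) ⊕ Fin e) : Set X :=
  {i | ∃ t : Fin e, t.val = 0 ∧ E i = Sum.inr t}

theorem subsingleton_markedLabels {X : Type*} {m k e : ℕ} (E : X ≃ (ZMod m × Fin k) ⊕ Fin e) :
    (markedLabels E).Subsingleton := by
  rintro i ⟨t, ht, hi⟩ j ⟨s, hs, hj⟩
  apply E.injective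
  rw [hi, hj, Fin.ext (ht.trans hs.symm)]

theorem apply_of_mem_markedLabels {X : Type*} {σ : Equiv.Perm X} {m k e : ℕ}
    {E : X ≃ (ZMod m × Fin k) ⊕ Fin e} (hE : ∀ i, E (σ i) = shift 1 (E i)) {i : X}
    (hi : i ∈ markedLabels E) : σ i = i := by
  obtain ⟨t, -, ht⟩ := hi
  apply E.injective
  rw [hE, ht]
  rfl

/-- The configurations with multiplier `ζ` are exactly those of the diagonal family. -/
theorem eigenLocus_eq_familyLocus {n m r e : ℕ} (hm : 2 ≤ m) {σ : Equiv.Perm (Fin (n + 1))}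
    {E : Fin (n + 1) ≃ (ZMod m × Fin (r + 1)) ⊕ Fin e} (hE : ∀ i, E (σ i) = shift 1 (E i))
    (he : e ≤ 2) {ζ : ℂ} (hζ : IsPrimitiveRoot ζ m) :
    eigenLocus σ (markedLabels E) ζ = familyLocus fun (x : Fin r → ℂ) i => diagVec ζ x (E i) := by
  have : NeZero m := ⟨by omega⟩
  have : Fact (1 < m) := ⟨hm⟩
  have hζ1 : ζ ≠ 1 := hζ.ne_one (by omega)
  ext z
  constructor
  · rintro ⟨q, hzq, hq, hA⟩
    have hinj := hzq.injective
    have fixed := fixed_iff_of_dil hζ1 hinj hq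
    have coordE : ∀ (l : ZMod m) (j : Fin (r + 1)),
        E.symm (Sum.inl (l, j)) = (σ ^ l.val) (E.symm (Sum.inl (0, j))) := by
      intro l j
      apply E.injective
      rw [coordinates_pow hE]
      simp [shift]
    have moved : ∀ j, ¬σ (E.symm (Sum.inl (0, j))) = E.symm (Sum.inl (0, j)) := by
      intro j h
      have := congrArg E h
      rw [hE] at this
      simp [shift] at this
    have finite : ∀ j, ∃ y : ℂ, y ≠ 0 ∧ q (E.symm (Sum.inl (0, j))) = y := by
      intro j
      have h := moved j
      rw [fixed, not_or] at h
      obtain ⟨y, hy⟩ := OnePoint.ne_infty_iff_exists.1 h.1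
      exact ⟨y, fun h0 => h.2 (by rw [← hy, h0]), hy.symm⟩
    choose y hy0 hy using finite
    -- Rescaling brings the base point of the first cycle to `1`.
    obtain ⟨d, hd⟩ := exists_smul_eq_dil (inv_ne_zero (hy0 0))
    let x : Fin r → ℂ := fun j => (y 0)⁻¹ * y j.succ
    have hx : ∀ j, Fin.cons (α := fun _ => ℂ) 1 x j = (y 0)⁻¹ * y j := by
      intro j
      refine Fin.cases ?_ (fun j => ?_) j
      · simp [hy0]
      · simp [x]
    have value : ∀ i, dil (y 0)⁻¹ (q i) = pt (diagVec ζ x (E i)) := by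
      intro i
      obtain ⟨p, rfl⟩ := E.symm.surjective i
      rw [Equiv.apply_symm_apply]
      rcases p with ⟨l, j⟩ | t
      · rw [coordE, eq_dil_pow hq, hy, dil_coe, dil_coe]
        simp only [diagVec, Sum.elim_inl, hx]
        rw [pt_of_ne (by simp), OnePoint.coe_eq_coe]
        simp
        ring
      · simp only [diagVec, Sum.elim_inr]
        split_ifs with ht
        · rw [hA _ ⟨t, ht, by simp⟩]
          simp [pt, dil_infty]
        · have hfix : σ (E.symm (Sum.inr t)) = E.symm (Sum.inr t) := by
            apply E.injective
            rw [hE]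
            simp [shift]
          rcases (fixed _).1 hfix with h | h
          · have ht' := t.isLt
            have h0 := hA (E.symm (Sum.inr ⟨0, by omega⟩)) ⟨⟨0, by omega⟩, rfl, by simp⟩
            rw [← h0] at h
            have := E.symm.injective (hinj h)
            simp only [Sum.inr.injEq, Fin.ext_iff] at this
            exact absurd this ht
          · rw [h]
            simp [pt, dil_coe]
    have hrep : Represents z fun i => pt (diagVec ζ x (E i)) := by
      obtain ⟨h, hh⟩ := hzq
      exact ⟨d * h, fun i => by rw [mul_smul, hh, hd, value]⟩
    exact ⟨x, nondegenerate_of_injective (fun i => diagVec_ne_zero ζ x _) hrep.injective, hrep⟩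
  · rintro ⟨x, -, hz⟩
    refine ⟨_, hz, fun i => ?_, ?_⟩
    · rw [dil_diagVec hm hζ.pow_eq_one, ← hE]
    · rintro i ⟨t, ht, hi⟩
      simp [hi, diagVec, ht, pt]

theorem isPreconnected_eigenLocus {n m r e : ℕ} (hn : 3 ≤ n) (hm : 2 ≤ m)
    {σ : Equiv.Perm (Fin (n + 1))} {E : Fin (n + 1) ≃ (ZMod m × Fin (r + 1)) ⊕ Fin e}
    (hE : ∀ i, E (σ i) = shift 1 (E i)) (he : e ≤ 2) {ζ : ℂ} (hζ : IsPrimitiveRoot ζ m) :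
    IsPreconnected (eigenLocus σ (markedLabels E) ζ) := by
  rw [eigenLocus_eq_familyLocus hm hE he hζ]
  exact isPreconnected_familyLocus hn (fun i c => contDiff_diagVec ζ (E i) c)
    fun i c x y t => diagVec_line ζ (E i) c x y t

/-- Three points of the diagonal family do not move: those of the first cycle, or, if that cycle
has length two, its points and a fixed point. -/
theorem isComplexSubmanifold_eigenLocus {n m r e : ℕ} (hn : 3 ≤ n) (hm : 2 ≤ m)
    {σ : Equiv.Perm (Fin (n + 1))} {E : Fin (n + 1) ≃ (ZMod m × Fin (r + 1)) ⊕ Fin e}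
    (hE : ∀ i, E (σ i) = shift 1 (E i)) (he : e ≤ 2) {ζ : ℂ} (hζ : IsPrimitiveRoot ζ m)
    (h3 : 3 ≤ m ∨ 0 < e) (hne : (eigenLocus σ (markedLabels E) ζ).Nonempty) :
    IsComplexSubmanifold (Subtype.val '' eigenLocus σ (markedLabels E) ζ) r := by
  have : NeZero m := ⟨by omega⟩
  have : Fact (1 < m) := ⟨hm⟩
  rw [eigenLocus_eq_familyLocus hm hE he hζ] at hne ⊢
  have h01 : E.symm (Sum.inl (0, 0)) ≠ E.symm (Sum.inl (1, 0)) := by simp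
  have hJ : ∀ (x : Fin r → ℂ) (j : Fin r),
      diagVec ζ x (E (E.symm (Sum.inl ((0 : ZMod m), j.succ)))) = ![x j, 1] := by
    intro x j
    simp [diagVec]
  rcases h3 with h3 | h0
  · have h2 : ((2 : ℕ) : ZMod m) ≠ 0 := by
      rw [Ne, ZMod.natCast_eq_zero_iff]
      exact fun h => by have := Nat.le_of_dvd (by omega) h; omega
    have h2' : ((2 : ℕ) : ZMod m) ≠ 1 := by
      intro h
      apply one_ne_zero (α := ZMod m)
      push_cast at h
      linear_combination h
    refine isComplexSubmanifold_familyLocus hn (fun i c => contDiff_diagVec ζ (E i) c)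
      (a := E.symm (Sum.inl (0, 0))) (b := E.symm (Sum.inl (1, 0)))
      (c := E.symm (Sum.inl ((2 : ℕ), 0))) h01 ?_ ?_ (wa := ![1, 1]) (wb := ![ζ, 1])
      (wc := ![ζ ^ 2, 1]) ?_ ?_ ?_ (J := fun j => E.symm (Sum.inl (0, j.succ))) ?_ hJ hne
    · simpa using h2.symm
    · simpa using h2'.symm
    · intro x
      simp [diagVec]
    · intro x
      simp [diagVec, ZMod.val_one]
    · intro x
      simp only [Equiv.apply_symm_apply, diagVec, Sum.elim_inl]
      rw [ZMod.val_natCast, Nat.mod_eq_of_lt (by omega)]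
      simp
    · intro j
      simpa using (Fin.succ_ne_zero j).symm
  · refine isComplexSubmanifold_familyLocus hn (fun i c => contDiff_diagVec ζ (E i) c)
      (a := E.symm (Sum.inr ⟨0, h0⟩)) (b := E.symm (Sum.inl (0, 0)))
      (c := E.symm (Sum.inl (1, 0))) ?_ ?_ h01 (wa := ![1, 0]) (wb := ![1, 1])
      (wc := ![ζ, 1]) ?_ ?_ ?_ (J := fun j => E.symm (Sum.inl (0, j.succ))) ?_ hJ hne
    · simp
    · simp
    · intro x
      simp [diagVec]
    · intro x
      simp [diagVec]
    · intro x
      simp [diagVec, ZMod.val_one]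
    · intro j
      simp

/-! ### Involutions without marked fixed points -/

theorem pt_scale {c : ℂ} (hc : c ≠ 0) (a b : ℂ) : pt ![c * a, c * b] = pt ![a, b] := by
  by_cases h : b = 0
  · simp [pt, h]
  · simp [pt, h, hc, mul_div_mul_left _ _ hc]

/-- First homogeneous coordinates of the base points `∞, 1, x_1, x_2, …` of the cycles. -/
def baseFst {s : ℕ} (x : Fin (s + 1) → ℂ) : Fin (s + 2) → ℂ :=
  Fin.cons (α := fun _ => ℂ) 1 (Fin.cons (α := fun _ => ℂ) 1 fun j => x j.succ)

/-- Second homogeneous coordinates of the base points `∞, 1, x_1, x_2, …` of the cycles. -/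
def baseSnd {s : ℕ} : Fin (s + 2) → ℂ := Fin.cons (α := fun _ => ℂ) 0 1

/-- Homogeneous coordinates of the configurations made up of the pairs exchanged by the involution
`y ↦ c / y`, the first two of them being `{∞, 0}` and `{1, c}`. The parameters are `x_0 = c` and
one point from each of the remaining pairs. -/
def involVec {s : ℕ} (x : Fin (s + 1) → ℂ) : (ZMod 2 × Fin (s + 2)) ⊕ Fin 0 → Fin 2 → ℂ :=
  Sum.elim (fun p => if p.1 = 0 then ![baseFst x p.2, baseSnd p.2] else
    ![x 0 * baseSnd p.2, baseFst x p.2]) fun _ => ![1, 0]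

theorem contDiff_baseFst {s : ℕ} (j : Fin (s + 2)) :
    ContDiff ℂ 1 fun x : Fin (s + 1) → ℂ => baseFst x j := by
  refine Fin.cases contDiff_const (fun j => ?_) j
  refine Fin.cases contDiff_const (fun j => ?_) j
  simp only [baseFst, Fin.cons_succ]
  fun_prop

theorem baseFst_line {s : ℕ} (j : Fin (s + 2)) (x y : Fin (s + 1) → ℂ) (t : ℂ) :
    baseFst (x + t • (y - x)) j = baseFst x j + t * (baseFst y j - baseFst x j) := by
  refine Fin.cases (by simp [baseFst]) (fun j => ?_) j
  refine Fin.cases (by simp [baseFst]) (fun j => ?_) j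
  simp [baseFst]

theorem contDiff_involVec {s : ℕ} (p : (ZMod 2 × Fin (s + 2)) ⊕ Fin 0) (c : Fin 2) :
    ContDiff ℂ 1 fun x : Fin (s + 1) → ℂ => involVec x p c := by
  have h := contDiff_baseFst (s := s)
  rcases p with ⟨l, j⟩ | t
  · have := h j
    by_cases hl : l = 0 <;> fin_cases c <;> simp [involVec, hl] <;> fun_prop
  · exact t.elim0

theorem involVec_line {s : ℕ} (p : (ZMod 2 × Fin (s + 2)) ⊕ Fin 0) (c : Fin 2)
    (x y : Fin (s + 1) → ℂ) (t : ℂ) :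
    involVec (x + t • (y - x)) p c =
      involVec x p c + t * (involVec y p c - involVec x p c) := by
  rcases p with ⟨l, j⟩ | i
  · by_cases hl : l = 0 <;> fin_cases c <;> simp [involVec, hl, baseFst_line]
    ring
  · exact i.elim0

theorem base_ne_zero {s : ℕ} (x : Fin (s + 1) → ℂ) (j : Fin (s + 2)) :
    baseFst x j ≠ 0 ∨ (baseSnd j : ℂ) ≠ 0 := by
  refine Fin.cases (Or.inl (by simp [baseFst])) (fun j => Or.inr ?_) j
  simp [baseSnd]

theorem involVec_ne_zero {s : ℕ} {x : Fin (s + 1) → ℂ} (hx : x 0 ≠ 0)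
    (p : (ZMod 2 × Fin (s + 2)) ⊕ Fin 0) : involVec x p ≠ 0 := by
  intro h
  have h0 := congrFun h 0
  have h1 := congrFun h 1
  rcases p with ⟨l, j⟩ | i
  · have := base_ne_zero x j
    by_cases hl : l = 0 <;> simp [involVec, hl, hx] at h0 h1 <;> simp [h0, h1] at this
  · exact i.elim0

theorem eq_zero_or_eq_one (l : ZMod 2) : l = 0 ∨ l = 1 := by
  revert l
  decide

/-- The involution `y ↦ c / y` in homogeneous coordinates. -/
theorem exists_involution {c : ℂ} (hc : c ≠ 0) :
    ∃ g : GL (Fin 2) ℂ, ∀ v, v ≠ 0 → g • pt v = pt ![c * v 1, v 0] := by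
  refine ⟨Matrix.GeneralLinearGroup.mkOfDetNeZero !![0, c; 1, 0]
    (by simpa [Matrix.det_fin_two] using hc), fun v hv => ?_⟩
  rw [smul_pt _ hv, Matrix.mulVec_fin_two]
  simp [Matrix.GeneralLinearGroup.mkOfDetNeZero]

/-- A Möbius transformation exchanging `∞` and `0` has the form `y ↦ c / y`. -/
theorem smul_pt_of_swap {g : GL (Fin 2) ℂ} (h0 : g • (∞ : OnePoint ℂ) = ((0 : ℂ) : OnePoint ℂ))
    (h1 : g • ((0 : ℂ) : OnePoint ℂ) = ∞) :
    ∃ c : ℂ, c ≠ 0 ∧ ∀ v, v ≠ 0 → g • pt v = pt ![c * v 1, v 0] := by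
  have hdet := g.det_ne_zero
  rw [Matrix.det_fin_two] at hdet
  rw [smul_infty_eq_ite] at h0
  split_ifs at h0 with hc
  · simp at h0
  rw [OnePoint.coe_eq_coe, div_eq_zero_iff, or_iff_left hc] at h0
  rw [smul_some_eq_ite] at h1
  split_ifs at h1 with hd
  · rw [mul_zero, zero_add] at hd
    rw [h0, zero_mul, zero_sub, neg_ne_zero] at hdet
    refine ⟨g 0 1 / g 1 0, div_ne_zero (left_ne_zero_of_mul hdet) hc, fun v hv => ?_⟩
    rw [smul_pt g hv, Matrix.mulVec_fin_two, ← pt_scale hc (g 0 1 / g 1 0 * v 1)]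
    congr 1
    ext i
    fin_cases i
    · simp [h0]
      field_simp
    · simp [hd]
  · exact absurd h1 (OnePoint.coe_ne_infty _)

theorem Fix_eq_familyLocus {n s : ℕ} (hn : 3 ≤ n) {σ : Equiv.Perm (Fin (n + 1))}
    {E : Fin (n + 1) ≃ (ZMod 2 × Fin (s + 2)) ⊕ Fin 0} (hE : ∀ i, E (σ i) = shift 1 (E i)) :
    Fix (Theta n hn σ) = familyLocus fun (x : Fin (s + 1) → ℂ) i => involVec x (E i) := by
  have h11 : (1 : ZMod 2) + 1 = 0 := by decide
  ext z
  constructor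
  · intro hz
    obtain ⟨g, hg⟩ := (Theta_apply_eq_iff hn σ z z).1 hz
    have hinj := marking_injective z
    obtain ⟨k, k0, k1, k2⟩ := exists_mobius
      (hinj.ne (a₁ := E.symm (Sum.inl (0, 0))) (a₂ := E.symm (Sum.inl (1, 0))) (by simp))
      (hinj.ne (a₁ := E.symm (Sum.inl (0, 0))) (a₂ := E.symm (Sum.inl (0, 1))) (by simp))
      (hinj.ne (a₁ := E.symm (Sum.inl (1, 0))) (a₂ := E.symm (Sum.inl (0, 1))) (by simp))
    have hq : Function.Injective fun i => k • marking z.1 i := (MulAction.injective k).comp hinj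
    have step : ∀ l j, (k * g * k⁻¹) • k • marking z.1 (E.symm (Sum.inl (l, j))) =
        k • marking z.1 (E.symm (Sum.inl (l + 1, j))) := by
      intro l j
      have : σ (E.symm (Sum.inl (l, j))) = E.symm (Sum.inl (l + 1, j)) := by
        apply E.injective
        rw [hE]
        simp [shift]
      rw [mul_smul, inv_smul_smul, mul_smul, hg, this]
    have s0 := step 0 0
    have s1 := step 1 0
    rw [zero_add, k0, k1] at s0
    rw [h11, k0, k1] at s1
    obtain ⟨c, hc, hact⟩ := smul_pt_of_swap s0 s1
    have finite : ∀ j : Fin (s + 1), ∃ y : ℂ,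
        (y : OnePoint ℂ) = k • marking z.1 (E.symm (Sum.inl (0, j.succ))) := by
      intro j
      refine OnePoint.ne_infty_iff_exists.1 fun h => ?_
      have := hq (h.trans k0.symm)
      simp at this
    choose y hy using finite
    have hy0 : y 0 = 1 := OnePoint.coe_injective ((hy 0).trans k2)
    let x : Fin (s + 1) → ℂ := Fin.cons (α := fun _ => ℂ) c fun j => y j.succ
    have hx0 : x 0 = c := rfl
    have base : ∀ j, k • marking z.1 (E.symm (Sum.inl (0, j))) = pt ![baseFst x j, baseSnd j] := by
      intro j
      refine Fin.cases ?_ (fun j => ?_) j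
      · rw [k0]
        simp [pt, baseSnd]
      · rw [← hy]
        refine Fin.cases ?_ (fun j => ?_) j
        · simp [hy0, pt, baseSnd, baseFst]
        · simp [pt, baseSnd, baseFst, x]
    have value : ∀ i, k • marking z.1 i = pt (involVec x (E i)) := by
      intro i
      obtain ⟨p, rfl⟩ := E.symm.surjective i
      rw [Equiv.apply_symm_apply]
      rcases p with ⟨l, j⟩ | t
      · rcases eq_zero_or_eq_one l with rfl | rfl
        · rw [base]
          simp [involVec]
        · rw [← zero_add (1 : ZMod 2), ← step, base, hact]
          · simp [involVec, hx0]
          · intro h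
            have := base_ne_zero x j
            have e0 := congrFun h 0
            have e1 := congrFun h 1
            simp only [Matrix.cons_val_zero, Matrix.cons_val_one, Pi.zero_apply] at e0 e1
            simp [e0, e1] at this
      · exact t.elim0
    have hrep : Represents z fun i => pt (involVec x (E i)) := ⟨k, value⟩
    exact ⟨x, nondegenerate_of_injective (fun i => involVec_ne_zero hc _) hrep.injective, hrep⟩
  · rintro ⟨x, hx, h, hh⟩
    have hx0 : x 0 ≠ 0 := by
      have := hx (E.symm (Sum.inl (1, 0))) (E.symm (Sum.inl (1, 1))) (by simp)
      simpa [involVec, bracket, baseFst, baseSnd] using this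
    obtain ⟨g, hg⟩ := exists_involution hx0
    refine (Theta_apply_eq_iff hn σ z z).2 ⟨h⁻¹ * g * h, fun i => ?_⟩
    rw [mul_smul, mul_smul, hh, hg _ (involVec_ne_zero hx0 _), inv_smul_eq_iff, hh]
    change _ = pt (involVec x (E (σ i)))
    rw [hE]
    rcases E i with ⟨l, j⟩ | t
    · rcases eq_zero_or_eq_one l with rfl | rfl
      · simp [involVec, shift]
      · simp [involVec, shift, h11, pt_scale hx0]
    · exact t.elim0

theorem isPreconnected_Fix_of_involution {n s : ℕ} (hn : 3 ≤ n) {σ : Equiv.Perm (Fin (n + 1))}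
    {E : Fin (n + 1) ≃ (ZMod 2 × Fin (s + 2)) ⊕ Fin 0} (hE : ∀ i, E (σ i) = shift 1 (E i)) :
    IsPreconnected (Fix (Theta n hn σ)) := by
  rw [Fix_eq_familyLocus hn hE]
  exact isPreconnected_familyLocus hn (fun i c => contDiff_involVec (E i) c)
    fun i c x y t => involVec_line (E i) c x y t

theorem isComplexSubmanifold_Fix_of_involution {n s : ℕ} (hn : 3 ≤ n)
    {σ : Equiv.Perm (Fin (n + 1))} {E : Fin (n + 1) ≃ (ZMod 2 × Fin (s + 2)) ⊕ Fin 0}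
    (hE : ∀ i, E (σ i) = shift 1 (E i)) (hne : (Fix (Theta n hn σ)).Nonempty) :
    IsComplexSubmanifold (Subtype.val '' Fix (Theta n hn σ)) (s + 1) := by
  rw [Fix_eq_familyLocus hn hE] at hne ⊢
  refine isComplexSubmanifold_familyLocus hn (fun i c => contDiff_involVec (E i) c)
    (a := E.symm (Sum.inl (0, 0))) (b := E.symm (Sum.inl (1, 0)))
    (c := E.symm (Sum.inl (0, 1))) (by simp) (by simp) (by simp) (wa := ![1, 0]) (wb := ![0, 1])
    (wc := ![1, 1]) ?_ ?_ ?_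
    (J := Fin.cons (α := fun _ => Fin (n + 1)) (E.symm (Sum.inl (1, 1)))
      fun j => E.symm (Sum.inl (0, j.succ.succ))) ?_ ?_ hne
  · intro x
    simp [involVec, baseFst, baseSnd]
  · intro x
    simp [involVec, baseFst, baseSnd]
  · intro x
    simp [involVec, baseFst, baseSnd]
  · intro j
    refine Fin.cases ?_ (fun j => ?_) j
    · simp
    · simpa using (Fin.succ_ne_zero j.succ).symm
  · intro x j
    refine Fin.cases ?_ (fun j => ?_) j
    · simp [involVec, baseFst, baseSnd]
    · simp [involVec, baseFst, baseSnd]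

/-! ### Separation of the eigenloci -/

/-- A union of finitely many non-empty connected sets, on which a continuous function takes
constant values that distinguish the different sets, has these sets as connected components. -/
theorem components_iUnion {X ι : Type*} [TopologicalSpace X] [Finite ι] {F : ι → Set X}
    {χ : X → ℂ} (hχ : Continuous χ) {I : ι → ℂ} (hF : ∀ i, IsPreconnected (F i))
    (hne : ∀ i, (F i).Nonempty) (hI : ∀ i, ∀ z ∈ F i, χ z = I i)
    (sep : ∀ i j, I i = I j → F i = F j) : components (⋃ i, F i) = Set.range F := by
  have comp : ∀ i, ∀ x ∈ F i, connectedComponentIn (⋃ i, F i) x = F i := by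
    intro i x hx
    have hxU : x ∈ ⋃ i, F i := Set.mem_iUnion.2 ⟨i, hx⟩
    apply Set.Subset.antisymm
    · intro y hy
      have hpre : IsPreconnected (χ '' connectedComponentIn (⋃ i, F i) x) :=
        isPreconnected_connectedComponentIn.image _ hχ.continuousOn
      have hsub : χ '' connectedComponentIn (⋃ i, F i) x ⊆ Set.range I := by
        rintro _ ⟨w, hw, rfl⟩
        obtain ⟨j, hj⟩ := Set.mem_iUnion.1 (connectedComponentIn_subset _ _ hw)
        exact ⟨j, (hI j w hj).symm⟩
      have hss := (Set.finite_range I).countable.isTotallyDisconnected _ hsub hpre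
      obtain ⟨j, hj⟩ := Set.mem_iUnion.1 (connectedComponentIn_subset _ _ hy)
      have e : χ y = χ x :=
        hss (Set.mem_image_of_mem _ hy) (Set.mem_image_of_mem _ (mem_connectedComponentIn hxU))
      rw [hI j y hj, hI i x hx] at e
      rwa [← sep j i e]
    · exact (hF i).subset_connectedComponentIn hx (Set.subset_iUnion F i)
  ext S
  constructor
  · rintro ⟨x, hx, rfl⟩
    obtain ⟨i, hi⟩ := Set.mem_iUnion.1 hx
    exact ⟨i, (comp i x hi).symm⟩
  · rintro ⟨i, rfl⟩
    obtain ⟨x, hx⟩ := hne i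
    exact ⟨x, Set.mem_iUnion.2 ⟨i, hx⟩, comp i x hx⟩

theorem components_of_isConnected {X : Type*} [TopologicalSpace X] {F : Set X}
    (hF : IsConnected F) : components F = {F} := by
  have key : ∀ x ∈ F, connectedComponentIn F x = F := fun x hx =>
    hF.2.connectedComponentIn hx
  ext S
  constructor
  · rintro ⟨x, hx, rfl⟩
    exact key x hx
  · rintro rfl
    obtain ⟨x, hx⟩ := hF.1
    exact ⟨x, hx, key x hx⟩

theorem continuous_crossRatio_markingVec {n : ℕ} {a b c d : Fin (n + 1)} (had : a ≠ d)
    (hbc : b ≠ c) : Continuous fun z : Omega n =>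
      crossRatio (markingVec z.1 a) (markingVec z.1 b) (markingVec z.1 c) (markingVec z.1 d) := by
  rw [continuous_iff_continuousAt]
  intro z
  have h := contDiffAt_crossRatio (x := z.1) (fun k => (contDiff_markingVec a k).contDiffAt)
    (fun k => (contDiff_markingVec b k).contDiffAt) (fun k => (contDiff_markingVec c k).contDiffAt)
    (fun k => (contDiff_markingVec d k).contDiffAt) (bracket_markingVec_ne_zero z had)
    (bracket_markingVec_ne_zero z hbc)
  exact h.continuousAt.comp continuous_subtype_val.continuousAt

theorem exists_crossRatio_eq {n m r e : ℕ} (hm : 2 ≤ m) {σ : Equiv.Perm (Fin (n + 1))}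
    {E : Fin (n + 1) ≃ (ZMod m × Fin (r + 1)) ⊕ Fin e} (hE : ∀ i, E (σ i) = shift 1 (E i))
    (he : e ≤ 2) {ζ : ℂ} (hζ : IsPrimitiveRoot ζ m) {z : Omega n}
    (hz : z ∈ eigenLocus σ (markedLabels E) ζ) :
    ∃ x : Fin r → ℂ, ∀ a b c d, a ≠ b → a ≠ c → b ≠ c → a ≠ d →
      crossRatio (markingVec z.1 (E.symm a)) (markingVec z.1 (E.symm b))
        (markingVec z.1 (E.symm c)) (markingVec z.1 (E.symm d)) =
        crossRatio (diagVec ζ x a) (diagVec ζ x b) (diagVec ζ x c) (diagVec ζ x d) := by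
  rw [eigenLocus_eq_familyLocus hm hE he hζ] at hz
  obtain ⟨x, hx, hz⟩ := hz
  refine ⟨x, fun a b c d hab hac hbc had => ?_⟩
  have := hz.crossRatio_eq hx (E.symm.injective.ne hab) (E.symm.injective.ne hac)
    (E.symm.injective.ne hbc) (E.symm.injective.ne had)
  simpa using this

theorem diagVec_natCast {m r e : ℕ} (ζ : ℂ) (x : Fin r → ℂ) {l : ℕ} (hl : l < m) :
    diagVec (e := e) ζ x (Sum.inl ((l : ZMod m), 0)) = ![ζ ^ l, 1] := by
  simp [diagVec, ZMod.val_natCast, Nat.mod_eq_of_lt hl]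

theorem natCast_ne_natCast {m a b : ℕ} (ha : a < m) (hb : b < m) (h : a ≠ b) :
    (a : ZMod m) ≠ b := by
  rw [Ne, ZMod.natCast_eq_natCast_iff]
  exact fun e => h (Nat.ModEq.eq_of_lt_of_lt e ha hb)

/-- The multiplier `ζ`, up to inversion if there is no marked fixed point, is determined by a
continuous function of the configuration: `1 + ζ` is the cross-ratio of the marked fixed point and
three consecutive points of a cycle, and `1 + 1 / (ζ + 1 + ζ⁻¹)` is the cross-ratio of four
consecutive points of a cycle. For cycles of length three without a marked fixed point there is
nothing to separate, since the two primitive cube roots of unity are mutually inverse. -/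
theorem exists_separating_function {n m r e : ℕ} (hm : 3 ≤ m) {σ : Equiv.Perm (Fin (n + 1))}
    {E : Fin (n + 1) ≃ (ZMod m × Fin (r + 1)) ⊕ Fin e} (hE : ∀ i, E (σ i) = shift 1 (E i))
    (he : e ≤ 2) :
    ∃ (χ : Omega n → ℂ) (I : ℂ → ℂ), Continuous χ ∧
      (∀ ζ, IsPrimitiveRoot ζ m → ∀ z ∈ eigenLocus σ (markedLabels E) ζ, χ z = I ζ) ∧
      ∀ ζ ω, IsPrimitiveRoot ζ m → IsPrimitiveRoot ω m → I ζ = I ω →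
        ω = ζ ∨ e = 0 ∧ ζ * ω = 1 := by
  have hm2 : 2 ≤ m := by omega
  let c : ℕ → (ZMod m × Fin (r + 1)) ⊕ Fin e := fun l => Sum.inl ((l : ZMod m), 0)
  have hc : ∀ a b, a < m → b < m → a ≠ b → c a ≠ c b := fun a b ha hb hab h =>
    natCast_ne_natCast ha hb hab (by simpa [c] using h)
  rcases Nat.eq_zero_or_pos e with h0 | h0
  · rcases hm.eq_or_lt with h3 | h4
    · refine ⟨fun _ => 0, fun _ => 0, continuous_const, fun _ _ _ _ => rfl, ?_⟩
      intro ζ ω hζ hω _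
      subst h3
      have cyc : ∀ ξ : ℂ, IsPrimitiveRoot ξ 3 → ξ ^ 2 + ξ + 1 = 0 := by
        intro ξ hξ
        have h1 : ξ - 1 ≠ 0 := sub_ne_zero.2 (hξ.ne_one (by norm_num))
        apply mul_left_cancel₀ h1
        linear_combination hξ.pow_eq_one
      have e1 := cyc ζ hζ
      have e2 := cyc ω hω
      have : (ω - ζ) * (ω + ζ + 1) = 0 := by linear_combination e2 - e1
      rcases mul_eq_zero.1 this with h | h
      · exact Or.inl (sub_eq_zero.1 h)
      · exact Or.inr ⟨h0, by linear_combination ζ * h - e1⟩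
    · refine ⟨fun z => crossRatio (markingVec z.1 (E.symm (c 0))) (markingVec z.1 (E.symm (c 1)))
        (markingVec z.1 (E.symm (c 2))) (markingVec z.1 (E.symm (c 3))),
        fun ζ => 1 + ζ / (ζ ^ 2 + ζ + 1), continuous_crossRatio_markingVec
          (E.symm.injective.ne (hc 0 3 (by omega) (by omega) (by omega)))
          (E.symm.injective.ne (hc 1 2 (by omega) (by omega) (by omega))), ?_, ?_⟩
      · intro ζ hζ z hz
        obtain ⟨x, hx⟩ := exists_crossRatio_eq hm2 hE he hζ hz
        refine (hx _ _ _ _ (hc 0 1 (by omega) (by omega) (by omega))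
          (hc 0 2 (by omega) (by omega) (by omega)) (hc 1 2 (by omega) (by omega) (by omega))
          (hc 0 3 (by omega) (by omega) (by omega))).trans ?_
        simp only [c]
        rw [diagVec_natCast ζ x (by omega), diagVec_natCast ζ x (by omega),
          diagVec_natCast ζ x (by omega), diagVec_natCast ζ x (by omega)]
        have h1 : 1 - ζ ≠ 0 := sub_ne_zero.2 (hζ.ne_one (by omega)).symm
        have h3 : ζ ^ 2 + ζ + 1 ≠ 0 := by
          intro h
          exact hζ.pow_ne_one_of_pos_of_lt (l := 3) (by norm_num) h4
            (by linear_combination (ζ - 1) * h)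
        have hz0 : ζ ≠ 0 := hζ.ne_zero (by omega)
        have e1 : bracket ![ζ ^ 0, 1] ![ζ ^ 3, 1] = (1 - ζ) * (ζ ^ 2 + ζ + 1) := by
          simp [bracket]
          ring
        have e2 : bracket ![ζ ^ 1, 1] ![ζ ^ 2, 1] = ζ * (1 - ζ) := by
          simp [bracket]
          ring
        have e3 : bracket ![ζ ^ 1, 1] ![ζ ^ 3, 1] = ζ * (1 - ζ ^ 2) := by
          simp [bracket]
          ring
        have e4 : bracket ![ζ ^ 0, 1] ![ζ ^ 2, 1] = 1 - ζ ^ 2 := by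
          simp [bracket]
        rw [crossRatio, e1, e2, e3, e4, one_add_div h3,
          div_eq_div_iff (mul_ne_zero (mul_ne_zero h1 h3) (mul_ne_zero hz0 h1)) h3]
        ring
      · intro ζ ω hζ hω h
        have nz : ∀ ξ : ℂ, IsPrimitiveRoot ξ m → ξ ^ 2 + ξ + 1 ≠ 0 := by
          intro ξ hξ h
          exact hξ.pow_ne_one_of_pos_of_lt (l := 3) (by norm_num) h4
            (by linear_combination (ξ - 1) * h)
        have h' := add_left_cancel h
        rw [div_eq_div_iff (nz ζ hζ) (nz ω hω)] at h'
        have : (ω - ζ) * (ζ * ω - 1) = 0 := by linear_combination h'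
        rcases mul_eq_zero.1 this with h | h
        · exact Or.inl (sub_eq_zero.1 h)
        · exact Or.inr ⟨h0, sub_eq_zero.1 h⟩
  · let p : (ZMod m × Fin (r + 1)) ⊕ Fin e := Sum.inr ⟨0, h0⟩
    have hp : ∀ l, p ≠ c l := fun l => Sum.inr_ne_inl
    refine ⟨fun z => crossRatio (markingVec z.1 (E.symm p)) (markingVec z.1 (E.symm (c 0)))
        (markingVec z.1 (E.symm (c 1))) (markingVec z.1 (E.symm (c 2))),
        fun ζ => 1 + ζ, continuous_crossRatio_markingVec
          (E.symm.injective.ne (hp 2))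
          (E.symm.injective.ne (hc 0 1 (by omega) (by omega) (by omega))), ?_, ?_⟩
    · intro ζ hζ z hz
      obtain ⟨x, hx⟩ := exists_crossRatio_eq hm2 hE he hζ hz
      refine (hx _ _ _ _ (hp 0) (hp 1) (hc 0 1 (by omega) (by omega) (by omega)) (hp 2)).trans ?_
      simp only [c]
      rw [diagVec_natCast ζ x (by omega), diagVec_natCast ζ x (by omega),
        diagVec_natCast ζ x (by omega)]
      have h1 : 1 - ζ ≠ 0 := sub_ne_zero.2 (hζ.ne_one (by omega)).symm
      simp [crossRatio, bracket, p, diagVec]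
      field_simp
      ring
    · intro ζ ω _ _ h
      exact Or.inl (add_left_cancel h).symm

theorem exists_pt_eq (p : OnePoint ℂ) : ∃ v, v ≠ 0 ∧ pt v = p := by
  induction p using OnePoint.rec with
  | infty => exact ⟨![1, 0], fun h => by simpa using congrFun h 0, by simp [pt]⟩
  | coe x => exact ⟨![x, 1], fun h => by simpa using congrFun h 1, by simp [pt]⟩

/-- The inversion `y ↦ 1 / y` exchanges the multipliers `ζ` and `ζ⁻¹`. -/
theorem eigenLocus_empty_eq {n : ℕ} (σ : Equiv.Perm (Fin (n + 1))) {ζ ω : ℂ} (h : ζ * ω = 1) :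
    eigenLocus σ ∅ ζ = eigenLocus σ ∅ ω := by
  have key : ∀ ζ ω : ℂ, ζ * ω = 1 → eigenLocus σ ∅ ζ ⊆ eigenLocus σ ∅ ω := by
    rintro ζ ω h z ⟨q, ⟨k, hk⟩, hq, -⟩
    have hζ : ζ ≠ 0 := left_ne_zero_of_mul_eq_one h
    obtain ⟨g, hg⟩ := exists_involution one_ne_zero
    refine ⟨fun i => g • q i, ⟨g * k, fun i => by rw [mul_smul, hk]⟩, fun i => ?_, by simp⟩
    simp only [hq]
    obtain ⟨v, hv, hvq⟩ := exists_pt_eq (q i)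
    have hv' : ![ζ * v 0, v 1] ≠ 0 := by
      intro e
      have e0 := congrFun e 0
      have e1 := congrFun e 1
      simp only [Matrix.cons_val_zero, Matrix.cons_val_one, Pi.zero_apply, mul_eq_zero, hζ,
        false_or] at e0 e1
      exact fst_ne_zero hv e1 e0
    rw [← hvq, dil_pt, hg _ hv', hg _ hv, dil_pt]
    have e := pt_scale hζ (ω * v 1) (v 0)
    rw [← mul_assoc, h, one_mul] at e
    simpa using e
  exact (key ζ ω h).antisymm (key ω ζ (by rw [mul_comm, h]))

/-! ### The normaliser permutes the eigenloci -/

theorem Theta_mem_eigenLocus {n : ℕ} (hn : 3 ≤ n) {σ τ : Equiv.Perm (Fin (n + 1))} {s t : ℕ}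
    (hτ : τ * σ = σ ^ s * τ) (hst : σ ^ (s * t) = σ) {A : Set (Fin (n + 1))}
    (hA : ∀ i ∈ A, τ i = i) {ζ : ℂ} {z : Omega n} (hz : z ∈ eigenLocus σ A ζ) :
    Theta n hn τ z ∈ eigenLocus σ A (ζ ^ t) := by
  obtain ⟨q, ⟨h, hh⟩, hq, hqA⟩ := hz
  obtain ⟨g, hg⟩ := (Theta_apply_eq_iff hn τ z _).1 rfl
  let q' : Fin (n + 1) → OnePoint ℂ := fun i => q (τ.symm i)
  have hq' : ∀ i, q' (τ i) = q i := fun i => by simp [q']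
  have hs : ∀ i, q' ((σ ^ s) i) = dil ζ (q' i) := by
    intro i
    obtain ⟨i, rfl⟩ := τ.surjective i
    rw [← Equiv.Perm.mul_apply, ← hτ, Equiv.Perm.mul_apply, hq', hq, hq']
  refine ⟨q', ⟨h * g⁻¹, fun i => ?_⟩, fun i => ?_, fun i hi => ?_⟩
  · obtain ⟨i, rfl⟩ := τ.surjective i
    rw [← hg, mul_smul, inv_smul_smul, hh, hq']
  · rw [← eq_dil_pow hs, ← pow_mul, hst]
  · rw [← hA i hi, hq', hqA i hi]

/-- The permutation that multiplies the positions in all cycles by the unit `u`. -/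
def scaleCycles {X : Type*} {m k e : ℕ} (E : X ≃ (ZMod m × Fin k) ⊕ Fin e) (u : (ZMod m)ˣ) :
    Equiv.Perm X :=
  (E.trans (Equiv.sumCongr ((Units.mulLeft u).prodCongr (Equiv.refl _)) (Equiv.refl _))).trans
    E.symm

theorem apply_scaleCycles {X : Type*} {m k e : ℕ} (E : X ≃ (ZMod m × Fin k) ⊕ Fin e)
    (u : (ZMod m)ˣ) (i : X) :
    E (scaleCycles E u i) = Sum.map (fun p => ((u : ZMod m) * p.1, p.2)) id (E i) := by
  rw [scaleCycles, Equiv.trans_apply, Equiv.trans_apply, Equiv.apply_symm_apply]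
  rcases E i with ⟨l, j⟩ | t <;> rfl

theorem scaleCycles_inv {X : Type*} {m k e : ℕ} (E : X ≃ (ZMod m × Fin k) ⊕ Fin e)
    (u : (ZMod m)ˣ) : scaleCycles E u⁻¹ = (scaleCycles E u)⁻¹ := by
  rw [eq_inv_iff_mul_eq_one]
  ext i
  apply E.injective
  rw [Equiv.Perm.mul_apply, apply_scaleCycles, apply_scaleCycles]
  rcases h : E i with ⟨l, j⟩ | t <;> simp [h]

theorem scaleCycles_mul {X : Type*} {σ : Equiv.Perm X} {m k e : ℕ} [NeZero m]
    {E : X ≃ (ZMod m × Fin k) ⊕ Fin e} (hE : ∀ i, E (σ i) = shift 1 (E i)) (u : (ZMod m)ˣ) :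
    scaleCycles E u * σ = σ ^ (u : ZMod m).val * scaleCycles E u := by
  ext i
  apply E.injective
  rw [Equiv.Perm.mul_apply, Equiv.Perm.mul_apply, apply_scaleCycles, coordinates_pow hE,
    apply_scaleCycles, hE, ZMod.natCast_zmod_val]
  rcases h : E i with ⟨l, j⟩ | t <;> simp [shift, mul_add]

theorem pow_val_mul_val_inv {X : Type*} {σ : Equiv.Perm X} {m k e : ℕ} [NeZero m]
    {E : X ≃ (ZMod m × Fin k) ⊕ Fin e} (hE : ∀ i, E (σ i) = shift 1 (E i)) (u : (ZMod m)ˣ) :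
    σ ^ ((u : ZMod m).val * ((u⁻¹ : (ZMod m)ˣ) : ZMod m).val) = σ := by
  ext i
  apply E.injective
  rw [coordinates_pow hE, hE]
  congr 1
  push_cast
  rw [ZMod.natCast_zmod_val, ZMod.natCast_zmod_val, Units.mul_inv]

theorem scaleCycles_of_mem_markedLabels {X : Type*} {m k e : ℕ}
    {E : X ≃ (ZMod m × Fin k) ⊕ Fin e} (u : (ZMod m)ˣ) {i : X} (hi : i ∈ markedLabels E) :
    scaleCycles E u i = i := by
  obtain ⟨t, -, ht⟩ := hi
  apply E.injective
  rw [apply_scaleCycles, ht]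
  rfl

theorem mem_normalizer_zpowers {G : Type*} [Group G] {S T : G} {a b : ℕ} (ha : S * T * S⁻¹ = T ^ a)
    (hb : S⁻¹ * T * S = T ^ b) : S ∈ Subgroup.normalizer (Subgroup.zpowers T : Set G) := by
  rw [Subgroup.mem_normalizer_iff]
  have key : ∀ (S : G) (a : ℕ), S * T * S⁻¹ = T ^ a → ∀ h ∈ Subgroup.zpowers T,
      S * h * S⁻¹ ∈ Subgroup.zpowers T := by
    rintro S a ha _ ⟨k, rfl⟩
    simp only [← conj_zpow, ha]
    exact Subgroup.zpow_mem _ (Subgroup.pow_mem _ (Subgroup.mem_zpowers T) a) k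
  refine fun h => ⟨key S a ha h, fun hh => ?_⟩
  have := key S⁻¹ b (by rw [inv_inv, hb]) _ hh
  simpa [mul_assoc] using this

theorem exists_normalizing {n m r e : ℕ} (hn : 3 ≤ n) (hm : 2 ≤ m)
    {σ : Equiv.Perm (Fin (n + 1))} {E : Fin (n + 1) ≃ (ZMod m × Fin (r + 1)) ⊕ Fin e}
    (hE : ∀ i, E (σ i) = shift 1 (E i)) {ζ ω : ℂ} (hζ : IsPrimitiveRoot ζ m)
    (hω : IsPrimitiveRoot ω m) :
    ∃ S ∈ torelliGroup n hn,
      S ∈ Subgroup.normalizer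
        (Subgroup.zpowers (Theta n hn σ) : Set (Equiv.Perm (Omega n))) ∧
      S '' eigenLocus σ (markedLabels E) ζ = eigenLocus σ (markedLabels E) ω := by
  have : NeZero m := ⟨by omega⟩
  obtain ⟨t, ht, htm, rfl⟩ := (hζ.isPrimitiveRoot_iff).1 hω
  let u : (ZMod m)ˣ := (ZMod.unitOfCoprime t htm)⁻¹
  have hu : ζ ^ ((u⁻¹ : (ZMod m)ˣ) : ZMod m).val = ζ ^ t := by
    simp [u, ZMod.val_natCast, Nat.mod_eq_of_lt ht]
  have hu' : (ζ ^ t) ^ (u : ZMod m).val = ζ := by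
    have h1 : ((t * (u : ZMod m).val : ℕ) : ZMod m) = (1 : ℕ) := by
      push_cast
      rw [ZMod.natCast_zmod_val, ← ZMod.coe_unitOfCoprime t htm]
      exact Units.mul_inv _
    rw [← pow_mul, ← pow_one ζ, ← pow_mul, one_mul]
    rw [ZMod.natCast_eq_natCast_iff] at h1
    rw [pow_eq_pow_mod _ hζ.pow_eq_one, h1, ← pow_eq_pow_mod _ hζ.pow_eq_one]
  have conj : ∀ u : (ZMod m)ˣ, Theta n hn (scaleCycles E u) * Theta n hn σ *
      (Theta n hn (scaleCycles E u))⁻¹ = Theta n hn σ ^ (u : ZMod m).val := by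
    intro u
    rw [← map_mul, scaleCycles_mul hE, map_mul, map_pow, mul_inv_cancel_right]
  have fwd : ∀ (u : (ZMod m)ˣ) (ξ : ℂ), ∀ z ∈ eigenLocus σ (markedLabels E) ξ,
      Theta n hn (scaleCycles E u) z ∈
        eigenLocus σ (markedLabels E) (ξ ^ ((u⁻¹ : (ZMod m)ˣ) : ZMod m).val) := fun u ξ z hz =>
    Theta_mem_eigenLocus hn (scaleCycles_mul hE u) (pow_val_mul_val_inv hE u)
      (fun i hi => scaleCycles_of_mem_markedLabels u hi) hz
  refine ⟨Theta n hn (scaleCycles E u), ⟨_, rfl⟩, mem_normalizer_zpowers (conj u)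
    (b := ((u⁻¹ : (ZMod m)ˣ) : ZMod m).val) ?_, ?_⟩
  · have := conj u⁻¹
    rwa [scaleCycles_inv, map_inv, inv_inv] at this
  · apply Set.Subset.antisymm
    · rintro _ ⟨z, hz, rfl⟩
      rw [← hu]
      exact fwd u ζ z hz
    · intro w hw
      have h := fwd u⁻¹ _ w hw
      rw [inv_inv, hu', scaleCycles_inv, map_inv] at h
      exact ⟨_, h, (Theta n hn (scaleCycles E u)).apply_symm_apply w⟩

/-! ### Counting components -/

theorem encard_isPrimitiveRoot {m : ℕ} (hm : m ≠ 0) :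
    {ζ : ℂ | IsPrimitiveRoot ζ m}.encard = Nat.totient m := by
  have : {ζ : ℂ | IsPrimitiveRoot ζ m} = (primitiveRoots m ℂ : Set ℂ) := by
    ext ζ
    simp [mem_primitiveRoots (Nat.pos_of_ne_zero hm)]
  rw [this, Set.encard_coe_eq_coe_finsetCard, Complex.card_primitiveRoots]

/-- A function on the primitive roots of unity that takes equal values exactly at mutually inverse
roots takes half as many values as there are roots. -/
theorem encard_image_isPrimitiveRoot {Y : Type*} {m : ℕ} (hm : 3 ≤ m) (F : ℂ → Y)
    (hF : ∀ ζ ω, IsPrimitiveRoot ζ m → IsPrimitiveRoot ω m →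
      (F ζ = F ω ↔ ω = ζ ∨ ζ * ω = 1)) :
    (F '' {ζ : ℂ | IsPrimitiveRoot ζ m}).encard = (Nat.totient m / 2 : ℕ) := by
  classical
  have mem : ∀ ζ : ℂ, ζ ∈ primitiveRoots m ℂ ↔ IsPrimitiveRoot ζ m := fun ζ =>
    mem_primitiveRoots (by omega)
  have e : F '' {ζ : ℂ | IsPrimitiveRoot ζ m} = ((primitiveRoots m ℂ).image F : Set Y) := by
    ext y
    simp [mem]
  have fiber : ∀ y ∈ (primitiveRoots m ℂ).image F,
      ((primitiveRoots m ℂ).filter fun ω => F ω = y).card = 2 := by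
    intro y hy
    obtain ⟨ζ, hζ, rfl⟩ := Finset.mem_image.1 hy
    rw [mem] at hζ
    have h0 : ζ ≠ 0 := hζ.ne_zero (by omega)
    rw [Finset.card_eq_two]
    refine ⟨ζ, ζ⁻¹, fun h => ?_, ?_⟩
    · exact hζ.pow_ne_one_of_pos_of_lt (l := 2) (by norm_num) (by omega)
        (by rw [pow_two]; nth_rewrite 2 [h]; exact mul_inv_cancel₀ h0)
    · ext ω
      rw [Finset.mem_filter, mem, Finset.mem_insert, Finset.mem_singleton]
      constructor
      · rintro ⟨hω, h⟩
        refine ((hF ζ ω hζ hω).1 h.symm).imp id fun h => ?_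
        exact eq_inv_of_mul_eq_one_right h
      · rintro (rfl | rfl)
        · exact ⟨hζ, rfl⟩
        · exact ⟨hζ.inv, ((hF ζ _ hζ hζ.inv).2 (Or.inr (mul_inv_cancel₀ h0))).symm⟩
  have hcard := Finset.card_eq_sum_card_image F (primitiveRoots m ℂ)
  rw [Finset.sum_congr rfl fiber, Finset.sum_const, Complex.card_primitiveRoots, smul_eq_mul]
    at hcard
  rw [e, Set.encard_coe_eq_coe_finsetCard, hcard, Nat.mul_div_cancel _ (by norm_num)]

/-! ### The structure of the fixed locus -/

/-- The permutation of the labels induced by a Möbius transformation of finite order `m` consists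
of cycles of length `m` and at most two fixed points. -/
theorem exists_coordinates_of_fixed {n m : ℕ} (hn : 3 ≤ n) (hm : 2 ≤ m) {σ : Equiv.Perm (Fin (n + 1))}
    (hσ : orderOf σ = m) (hfix : (Fix (Theta n hn σ)).Nonempty) :
    ∃ r e : ℕ, e ≤ 2 ∧ ∃ E : Fin (n + 1) ≃ (ZMod m × Fin (r + 1)) ⊕ Fin e,
      ∀ i, E (σ i) = shift 1 (E i) := by
  have hσ1 : σ ≠ 1 := by
    rintro rfl
    rw [orderOf_one] at hσ
    omega
  have : NeZero m := ⟨by omega⟩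
  obtain ⟨z, hz⟩ := hfix
  obtain ⟨ζ, hζ, q, hzq, hq, -⟩ :=
    exists_mem_eigenLocus hn hσ1 hz Set.subsingleton_empty (by simp)
  rw [hσ] at hζ
  obtain ⟨k, e, E, hE⟩ := exists_cycle_coordinates σ m
    (period_of_dil hm hζ hzq.injective hq)
  have he : e ≤ 2 := by
    by_contra! he
    have at_end : ∀ t : Fin e, q (E.symm (Sum.inr t)) ∈
        ({∞, ((0 : ℂ) : OnePoint ℂ)} : Set (OnePoint ℂ)) := by
      intro t
      refine (fixed_iff_of_dil (hζ.ne_one (by omega)) hzq.injective hq _).1 ?_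
      apply E.injective
      rw [hE]
      simp [shift]
    have hinj : Function.Injective fun t : Fin e => q (E.symm (Sum.inr t)) :=
      hzq.injective.comp (E.symm.injective.comp Sum.inr_injective)
    have h1 := Set.encard_le_encard (Set.range_subset_iff.2 at_end)
    rw [← Set.image_univ, hinj.encard_image, Set.encard_univ,
      ENat.card_eq_coe_fintype_card, Fintype.card_fin] at h1
    have h2 := h1.trans (Set.encard_insert_le _ _)
    rw [Set.encard_singleton] at h2
    have : e ≤ 1 + 1 := by exact_mod_cast h2
    omega
  rcases k with _ | r
  · exfalso
    refine hσ1 (Equiv.ext fun i => E.injective ?_)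
    rw [hE]
    show _ = E i
    rcases E i with ⟨l, j⟩ | t
    · exact j.elim0
    · rfl
  · exact ⟨r, e, he, E, hE⟩

theorem Fix_eq_iUnion {n m r e : ℕ} (hn : 3 ≤ n) (hm : 2 ≤ m) {σ : Equiv.Perm (Fin (n + 1))}
    (hσ : orderOf σ = m) {E : Fin (n + 1) ≃ (ZMod m × Fin (r + 1)) ⊕ Fin e}
    (hE : ∀ i, E (σ i) = shift 1 (E i)) :
    Fix (Theta n hn σ) =
      ⋃ ζ : {ζ : ℂ | IsPrimitiveRoot ζ m}, eigenLocus σ (markedLabels E) ζ := by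
  have hσ1 : σ ≠ 1 := by
    rintro rfl
    rw [orderOf_one] at hσ
    omega
  apply Set.Subset.antisymm
  · intro z hz
    obtain ⟨ζ, hζ, h⟩ := exists_mem_eigenLocus hn hσ1 hz (subsingleton_markedLabels E)
      fun i hi => apply_of_mem_markedLabels hE hi
    rw [hσ] at hζ
    exact Set.mem_iUnion.2 ⟨⟨ζ, hζ⟩, h⟩
  · exact Set.iUnion_subset fun ζ =>
      eigenLocus_subset_Fix hn σ _ (ζ.2.ne_zero (by omega))

theorem markedLabels_eq_empty {X : Type*} {m k e : ℕ} (E : X ≃ (ZMod m × Fin k) ⊕ Fin e)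
    (he : e = 0) : markedLabels E = ∅ := by
  subst he
  ext i
  simp [markedLabels]

/-- For an involution the fixed locus is connected and a submanifold: there is only one possible
multiplier if some label is fixed, and the family of the maps `y ↦ c / y` covers the other case. -/
theorem isConnected_Fix_of_two {n r e : ℕ} (hn : 4 ≤ n) {σ : Equiv.Perm (Fin (n + 1))}
    (hσ : orderOf σ = 2) {E : Fin (n + 1) ≃ (ZMod 2 × Fin (r + 1)) ⊕ Fin e}
    (hE : ∀ i, E (σ i) = shift 1 (E i)) (he : e ≤ 2)
    (hfix : (Fix (Theta n (Nat.le_of_succ_le hn) σ)).Nonempty) :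
    IsConnected (Fix (Theta n (Nat.le_of_succ_le hn) σ)) ∧
      IsComplexSubmanifold (Subtype.val '' Fix (Theta n (Nat.le_of_succ_le hn) σ)) r := by
  have hn3 := Nat.le_of_succ_le hn
  rcases Nat.eq_zero_or_pos e with rfl | h0
  · have hcard := card_of_coordinates E
    obtain ⟨s, rfl⟩ : ∃ s, r = s + 1 := ⟨r - 1, by omega⟩
    exact ⟨⟨hfix, isPreconnected_Fix_of_involution hn3 hE⟩,
      isComplexSubmanifold_Fix_of_involution hn3 hE hfix⟩
  · have hprim : IsPrimitiveRoot (-1 : ℂ) 2 := IsPrimitiveRoot.neg_one 0 (by norm_num)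
    have hF : Fix (Theta n hn3 σ) = eigenLocus σ (markedLabels E) (-1) := by
      rw [Fix_eq_iUnion hn3 le_rfl hσ hE]
      apply Set.Subset.antisymm
      · refine Set.iUnion_subset fun ζ => ?_
        rw [ζ.2.eq_neg_one_of_two_right]
      · exact Set.subset_iUnion (fun ζ : {ζ : ℂ | IsPrimitiveRoot ζ 2} =>
          eigenLocus σ (markedLabels E) ζ) ⟨-1, hprim⟩
    rw [hF] at hfix ⊢
    exact ⟨⟨hfix, isPreconnected_eigenLocus hn3 le_rfl hE he hprim⟩,
      isComplexSubmanifold_eigenLocus hn3 le_rfl hE he hprim (Or.inr h0) hfix⟩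

/-- Every eigenlocus is non-empty if the fixed locus is, since the normaliser permutes the
eigenloci transitively. -/
theorem eigenLocus_nonempty {n m r e : ℕ} (hn : 3 ≤ n) (hm : 2 ≤ m)
    {σ : Equiv.Perm (Fin (n + 1))} (hσ : orderOf σ = m)
    {E : Fin (n + 1) ≃ (ZMod m × Fin (r + 1)) ⊕ Fin e} (hE : ∀ i, E (σ i) = shift 1 (E i))
    (hfix : (Fix (Theta n hn σ)).Nonempty) {ω : ℂ} (hω : IsPrimitiveRoot ω m) :
    (eigenLocus σ (markedLabels E) ω).Nonempty := by
  obtain ⟨z, hz⟩ := hfix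
  rw [Fix_eq_iUnion hn hm hσ hE] at hz
  obtain ⟨ζ, hζ⟩ := Set.mem_iUnion.1 hz
  obtain ⟨S, -, -, hS⟩ := exists_normalizing hn hm hE ζ.2 hω
  rw [← hS]
  exact ⟨_, z, hζ, rfl⟩

theorem components_Fix {n m r e : ℕ} (hn : 3 ≤ n) (hm : 3 ≤ m)
    {σ : Equiv.Perm (Fin (n + 1))} (hσ : orderOf σ = m)
    {E : Fin (n + 1) ≃ (ZMod m × Fin (r + 1)) ⊕ Fin e} (hE : ∀ i, E (σ i) = shift 1 (E i))
    (he : e ≤ 2) (hfix : (Fix (Theta n hn σ)).Nonempty) :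
    components (Fix (Theta n hn σ)) =
        eigenLocus σ (markedLabels E) '' {ζ : ℂ | IsPrimitiveRoot ζ m} ∧
      ∀ ζ ω, IsPrimitiveRoot ζ m → IsPrimitiveRoot ω m →
        (eigenLocus σ (markedLabels E) ζ = eigenLocus σ (markedLabels E) ω ↔
          ω = ζ ∨ e = 0 ∧ ζ * ω = 1) := by
  have hm2 : 2 ≤ m := by omega
  obtain ⟨χ, I, hχ, hI, hsep⟩ := exists_separating_function hm hE he
  have hsep' : ∀ ζ ω, (ω = ζ ∨ e = 0 ∧ ζ * ω = 1) →
      eigenLocus σ (markedLabels E) ζ = eigenLocus σ (markedLabels E) ω := by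
    rintro ζ ω (rfl | ⟨h0, h⟩)
    · rfl
    · rw [markedLabels_eq_empty E h0]
      exact eigenLocus_empty_eq σ h
  have hfin : Finite {ζ : ℂ | IsPrimitiveRoot ζ m} := by
    refine Set.Finite.subset (primitiveRoots m ℂ).finite_toSet fun ζ hζ => ?_
    exact (mem_primitiveRoots (by omega)).2 hζ
  refine ⟨?_, fun ζ ω hζ hω => ⟨fun h => ?_, hsep' ζ ω⟩⟩
  · rw [Fix_eq_iUnion hn hm2 hσ hE, Set.image_eq_range]
    exact components_iUnion hχ (I := fun ζ : {ζ : ℂ | IsPrimitiveRoot ζ m} => I ζ)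
      (fun ζ => isPreconnected_eigenLocus hn hm2 hE he ζ.2)
      (fun ζ => eigenLocus_nonempty hn hm2 hσ hE hfix ζ.2) (fun ζ => hI ζ ζ.2)
      fun ζ ω h => hsep' ζ ω (hsep ζ ω ζ.2 ω.2 h)
  · obtain ⟨z, hz⟩ := eigenLocus_nonempty hn hm2 hσ hE hfix hζ
    exact hsep ζ ω hζ hω (by rw [← hI ζ hζ z hz, ← hI ω hω z (h ▸ hz)])

end

end MarkedSpheres

theorem theorem3 (n : ℕ) (hn : 4 ≤ n) (σ : Equiv.Perm (Fin (n + 1)))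
    (T : Equiv.Perm (MarkedSpheres.Omega n))
    (hT : T = MarkedSpheres.Theta n (Nat.le_of_succ_le hn) σ)
    (m : ℕ) (hm : 2 ≤ m) (horder : orderOf T = m)
    (hfix : (MarkedSpheres.Fix T).Nonempty) :
    ∃ r : ℕ, σ.cycleType.count m = r + 1 ∧
      (∀ F ∈ MarkedSpheres.components (MarkedSpheres.Fix T),
        MarkedSpheres.IsComplexSubmanifold (Subtype.val '' F) r) ∧
      (m = 2 → IsConnected (MarkedSpheres.Fix T)) ∧
      (3 ≤ m →
        (m ∣ n + 1 →
          (MarkedSpheres.components (MarkedSpheres.Fix T)).encard = (Nat.totient m / 2 : ℕ)) ∧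
        (¬ m ∣ n + 1 →
          (MarkedSpheres.components (MarkedSpheres.Fix T)).encard = Nat.totient m) ∧
        ∀ F₁ ∈ MarkedSpheres.components (MarkedSpheres.Fix T),
          ∀ F₂ ∈ MarkedSpheres.components (MarkedSpheres.Fix T),
            ∃ S ∈ MarkedSpheres.torelliGroup n (Nat.le_of_succ_le hn),
              S ∈ Subgroup.normalizer (Subgroup.zpowers T : Set (Equiv.Perm (MarkedSpheres.Omega n))) ∧
                S '' F₁ = F₂) := by
  have hn3 := Nat.le_of_succ_le hn
  subst hT
  have hσ : orderOf σ = m := by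
    rw [← horder, orderOf_injective _ (MarkedSpheres.Theta_injective hn)]
  obtain ⟨r, e, he, E, hE⟩ := MarkedSpheres.exists_coordinates_of_fixed hn3 hm hσ hfix
  have hcard : n + 1 = m * (r + 1) + e := by
    have : NeZero m := ⟨by omega⟩
    exact MarkedSpheres.card_of_coordinates E
  refine ⟨r, MarkedSpheres.count_cycleType_of_coordinates hm hE, ?_⟩
  obtain rfl | h3 : 2 = m ∨ 3 ≤ m := by omega
  · obtain ⟨hconn, hsub⟩ := MarkedSpheres.isConnected_Fix_of_two hn hσ hE he hfix
    refine ⟨?_, fun _ => hconn, fun h => by omega⟩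
    rw [MarkedSpheres.components_of_isConnected hconn]
    rintro _ rfl
    exact hsub
  · obtain ⟨hcomp, hsep⟩ := MarkedSpheres.components_Fix hn3 h3 hσ hE he hfix
    rw [hcomp]
    have hdvd : m ∣ n + 1 ↔ e = 0 := by
      rw [hcard, Nat.dvd_add_right (dvd_mul_right _ _)]
      refine ⟨fun h => ?_, fun h => by simp [h]⟩
      by_contra h0
      have := Nat.le_of_dvd (Nat.pos_of_ne_zero h0) h
      omega
    refine ⟨?_, fun h => by omega, fun _ => ⟨fun h => ?_, fun h => ?_, ?_⟩⟩
    · rintro _ ⟨ζ, hζ, rfl⟩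
      exact MarkedSpheres.isComplexSubmanifold_eigenLocus hn3 hm hE he hζ (Or.inl h3)
        (MarkedSpheres.eigenLocus_nonempty hn3 hm hσ hE hfix hζ)
    · refine MarkedSpheres.encard_image_isPrimitiveRoot h3 _ fun ζ ω hζ hω => ?_
      rw [hsep ζ ω hζ hω]
      simp [hdvd.1 h]
    · rw [Set.InjOn.encard_image, MarkedSpheres.encard_isPrimitiveRoot (by omega)]
      intro ζ hζ ω hω h'
      rcases (hsep ζ ω hζ hω).1 h' with h' | ⟨h0, -⟩
      · exact h'.symm
      · exact absurd (hdvd.2 h0) h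
    · rintro _ ⟨ζ, hζ, rfl⟩ _ ⟨ω, hω, rfl⟩
      exact MarkedSpheres.exists_normalizing hn3 hm hE hζ hω
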